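/- Let $M=(m_{ij})$ be a $2\times 2$ symmetrizable generalized intersection matrix: an integer matrix with $m_{11}=m_{22}=2$, $m_{12}<0\iff m_{21}<0$, $m_{12}>0\iff m_{21}>0$, and let $s_1,s_2>0$ be real numbers such that $\mathrm{diag}(s_1,s_2)M$ is symmetric. Let $K=2-\mathrm{rank}\,M$, let $H$ be the complex vector space with basis $h_1,h_2,d_1,\dots,d_K$, and let $\Pi=\{\alpha_1,\alpha_2\}\subset H^*$ be linearly independent with $\alpha_i(h_j)=m_{ji}$. On the real span of $\Pi$ put the symmetric bilinear form $(\alpha_i,\alpha_j)=s_im_{ij}$, so that $2(\alpha_i,\alpha_j)/(\alpha_i,\alpha_i)=m_{ij}$, and let $\rho_\alpha(\beta)=\beta-\frac{2(\beta,\alpha)}{(\alpha,\alpha)}\alpha$. Write $\mathscr B\sim\Pi$ if $\mathscr B$ is obtained from $\Pi$ by finitely many steps $\mathscr B'\mapsto(\mathscr B'\setminus\{\beta\})\cup\{\rho_\alpha(\beta)\}$ with $\alpha,\beta\in\mathscr B'$ (possibly $\alpha=\beta$). Let $\mathsf{Pra}(M)$ be the complex Lie algebra generated by $e_1,e_2,f_1,f_2$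 and the vector space $H$ with defining relations $[h,h']=0$, $[e_i,f_i]=h_i$, $[h,e_i]=\alpha_i(h)e_i$, $[h,f_i]=-\alpha_i(h)f_i$ $(h,h'\in H)$ and, for all $\mathscr B\sim\Pi$, all $\alpha,\beta\in\mathscr B$ and all $x,y,z$ of $H$-weight $\alpha,\beta,-\alpha$ respectively, - $(\mathrm{ad}\,x)^{1-2(\alpha,\beta)/(\alpha,\alpha)}(y)=0$ and $[z,y]=0$ if $(\alpha,\beta)<0$; - $(\mathrm{ad}\,z)^{1+2(\alpha,\beta)/(\alpha,\alpha)}(y)=0$ and $[x,y]=0$ if $(\alpha,\beta)>0$; - $[x,y]=0$ and $[z,y]=0$ if $(\alpha,\beta)=0$. For a symmetrizable generalized Cartan matrix $A$ with a realization $(H,\{h_i\},\{\alpha_i\})$ as above, the Kac–Moody algebra of $A$ is the complex Lie algebra generated by $e_i,f_i$ and $H$ with defining relations $[h,h']=0$, $[e_i,f_j]=\delta_{ij}h_i$, $[h,e_i]=\alpha_i(h)e_i$, $[h,f_i]=-\alpha_i(h)f_i$ and $(\mathrm{ad}\,e_i)^{1-a_{ij}}e_j=0=(\mathrm{ad}\,f_i)^{1-a_{ij}}f_j$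 for $i\ne j$. Then $\mathsf{Pra}(M)$ is a Kac–Moody algebra: it is isomorphic, as a complex Lie algebra, to the Kac–Moody algebra of the generalized Cartan matrix $A$ with $a_{ii}=2$ and $a_{ij}=-|m_{ij}|$ for $i\neq j$ (for some realization of $A$). Moreover, if $M$ itself is a generalized Cartan matrix, then there is an isomorphism from $\mathsf{Pra}(M)$ onto the Kac–Moody algebra of $M$ (with the same $H$ and $\Pi$) that maps $e_i\mapsto e_i$, $f_i\mapsto f_i$ and $h\mapsto h$ for all $h\in H$. -/

import Mathlib

noncomputable section

namespace GIM

/-- A generalized intersection matrix: an integer matrix with diagonal entries `2` whose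
off-diagonal entries are sign-symmetric. -/
structure IsGIM {n : ℕ} (M : Matrix (Fin n) (Fin n) ℤ) : Prop where
  diag : ∀ i, M i i = 2
  neg_iff : ∀ i j, i ≠ j → (M i j < 0 ↔ M j i < 0)
  pos_iff : ∀ i j, i ≠ j → (0 < M i j ↔ 0 < M j i)

/-- A generalized Cartan matrix. -/
structure IsGCM {n : ℕ} (A : Matrix (Fin n) (Fin n) ℤ) : Prop where
  diag : ∀ i, A i i = 2
  nonpos : ∀ i j, i ≠ j → A i j ≤ 0
  zero_iff : ∀ i j, A i j = 0 ↔ A j i = 0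

/-- `diag(s) M` is symmetric, with positive `s i`. (For a generalized intersection matrix, if
`diag(s) M` is symmetric with all `s i ≠ 0`, then `diag(|s|) M` is symmetric as well,
see `IsGIM.isSymmetrizer_abs`.) -/
structure IsSymmetrizer {n : ℕ} (M : Matrix (Fin n) (Fin n) ℤ) (s : Fin n → ℝ) : Prop where
  pos : ∀ i, 0 < s i
  symm : (Matrix.diagonal s * M.map (Int.cast : ℤ → ℝ)).IsSymm

/-- Requiring the symmetrizing diagonal matrix to be positive loses no generality. -/
theorem IsGIM.isSymmetrizer_abs {n : ℕ} {M : Matrix (Fin n) (Fin n) ℤ} (hM : IsGIM M)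
    {s : Fin n → ℝ} (h0 : ∀ i, s i ≠ 0)
    (hs : (Matrix.diagonal s * M.map (Int.cast : ℤ → ℝ)).IsSymm) :
    IsSymmetrizer M (fun i => |s i|) := by
  refine ⟨fun i => abs_pos.mpr (h0 i), ?_⟩
  ext i j
  have h := congrFun (congrFun hs i) j
  simp only [Matrix.transpose_apply, Matrix.diagonal_mul, Matrix.map_apply] at h ⊢
  rcases eq_or_ne i j with rfl | hij
  · rfl
  rcases lt_trichotomy (M i j) 0 with hlt | heq | hgt
  · have h2 := (hM.neg_iff i j hij).1 hlt
    have e := congrArg abs h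
    rw [abs_mul, abs_mul, abs_of_neg (Int.cast_lt_zero.mpr hlt),
      abs_of_neg (Int.cast_lt_zero.mpr h2)] at e
    linarith
  · have h2 : M j i = 0 := by
      have a := hM.neg_iff i j hij
      have b := hM.pos_iff i j hij
      omega
    simp [heq, h2]
  · have h2 := (hM.pos_iff i j hij).1 hgt
    have e := congrArg abs h
    rwa [abs_mul, abs_mul, abs_of_pos (Int.cast_pos.mpr hgt),
      abs_of_pos (Int.cast_pos.mpr h2)] at e

/-- The corank `K = n - rank M`. -/
def corank {n : ℕ} (M : Matrix (Fin n) (Fin n) ℤ) : ℕ :=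
  n - (M.map (Int.cast : ℤ → ℂ)).rank

/-- The complex vector space `H` with basis `h_1, …, h_n, d_1, …, d_K`. -/
abbrev Cartan {n : ℕ} (M : Matrix (Fin n) (Fin n) ℤ) : Type :=
  (Fin n ⊕ Fin (corank M)) → ℂ

/-- The basis vector `h_i` of `H`. -/
def coroot {n : ℕ} (M : Matrix (Fin n) (Fin n) ℤ) (i : Fin n) : Cartan M :=
  Pi.single (Sum.inl i) 1

/-- A realization of `M`: linearly independent `α_1, …, α_n` in the dual space of `H` with
`α_i (h_j) = m_{ji}`. -/
structure Realization {n : ℕ} (M : Matrix (Fin n) (Fin n) ℤ) where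
  root : Fin n → Module.Dual ℂ (Cartan M)
  linearIndependent : LinearIndependent ℂ root
  root_coroot : ∀ i j, root i (coroot M j) = (M j i : ℂ)

/-! ### The Lie algebra with the relations common to all the algebras considered -/

/-- The generators `e_i`, `f_i` and `h ∈ H`. -/
inductive Gen {n : ℕ} (M : Matrix (Fin n) (Fin n) ℤ) : Type
  | e : Fin n → Gen M
  | f : Fin n → Gen M
  | h : Cartan M → Gen M

/-- A generator as an element of the free Lie algebra. -/
abbrev free {n : ℕ} (M : Matrix (Fin n) (Fin n) ℤ) (g : Gen M) : FreeLieAlgebra ℂ (Gen M) :=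
  FreeLieAlgebra.of ℂ g

/-- Left-hand sides of the basic relations: the generators `h ∈ H` depend linearly on `h` and
commute, `[e_i, f_i] = h_i`, `[h, e_i] = α_i(h) e_i`, `[h, f_i] = - α_i(h) f_i`. -/
inductive BaseRel {n : ℕ} {M : Matrix (Fin n) (Fin n) ℤ} (R : Realization M) :
    FreeLieAlgebra ℂ (Gen M) → Prop
  | h_add (x y : Cartan M) : BaseRel R (free M (Gen.h (x + y)) -
      (free M (Gen.h x) + free M (Gen.h y)))
  | h_smul (c : ℂ) (x : Cartan M) : BaseRel R (free M (Gen.h (c • x)) -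
      c • free M (Gen.h x))
  | h_h (x y : Cartan M) : BaseRel R
      ⁅free M (Gen.h x), free M (Gen.h y)⁆
  | e_f (i : Fin n) : BaseRel R
      (⁅free M (Gen.e i), free M (Gen.f i)⁆ -
        free M (Gen.h (coroot M i)))
  | h_e (x : Cartan M) (i : Fin n) : BaseRel R
      (⁅free M (Gen.h x), free M (Gen.e i)⁆ -
        R.root i x • free M (Gen.e i))
  | h_f (x : Cartan M) (i : Fin n) : BaseRel R
      (⁅free M (Gen.h x), free M (Gen.f i)⁆ +
        R.root i x • free M (Gen.f i))

/-- The ideal generated by the basic relations. -/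
def baseIdeal {n : ℕ} {M : Matrix (Fin n) (Fin n) ℤ} (R : Realization M) :
    LieIdeal ℂ (FreeLieAlgebra ℂ (Gen M)) :=
  LieSubmodule.lieSpan ℂ _ {x | BaseRel R x}

/-- The Lie algebra generated by `e_i`, `f_i`, `h ∈ H` subject to the basic relations only. -/
abbrev Base {n : ℕ} {M : Matrix (Fin n) (Fin n) ℤ} (R : Realization M) : Type :=
  FreeLieAlgebra ℂ (Gen M) ⧸ baseIdeal R

/-- The image of a generator in `Base R`. -/
def Base.gen {n : ℕ} {M : Matrix (Fin n) (Fin n) ℤ} (R : Realization M) (g : Gen M) : Base R :=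
  LieSubmodule.Quotient.mk (FreeLieAlgebra.of ℂ g)

/-- `v` lies in the weight space `{v | [h, v] = χ(h) v for all h ∈ H}`. -/
def IsWeightVector {n : ℕ} {M : Matrix (Fin n) (Fin n) ℤ} (R : Realization M)
    (χ : Module.Dual ℂ (Cartan M)) (v : Base R) : Prop :=
  ∀ x : Cartan M, ⁅Base.gen R (Gen.h x), v⁆ = χ x • v

/-! ### Kac-Moody algebras -/

/-- Left-hand sides of the remaining defining relations of a Kac-Moody algebra. -/
inductive SerreRel {n : ℕ} {A : Matrix (Fin n) (Fin n) ℤ} (R : Realization A) : Base R → Prop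
  | e_f (i j : Fin n) (hij : i ≠ j) :
      SerreRel R ⁅Base.gen R (Gen.e i), Base.gen R (Gen.f j)⁆
  | serre_e (i j : Fin n) (hij : i ≠ j) :
      SerreRel R (((LieAlgebra.ad ℂ (Base R) (Base.gen R (Gen.e i))) ^ (1 - A i j).toNat)
        (Base.gen R (Gen.e j)))
  | serre_f (i j : Fin n) (hij : i ≠ j) :
      SerreRel R (((LieAlgebra.ad ℂ (Base R) (Base.gen R (Gen.f i))) ^ (1 - A i j).toNat)
        (Base.gen R (Gen.f j)))

/-- The ideal of `Base R` generated by `[e_i, f_j]` (`i ≠ j`) and the Serre relations. -/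
def serreIdeal {n : ℕ} {A : Matrix (Fin n) (Fin n) ℤ} (R : Realization A) :
    LieIdeal ℂ (Base R) :=
  LieSubmodule.lieSpan ℂ _ {x | SerreRel R x}

/-- The Kac-Moody algebra of the (symmetrizable) generalized Cartan matrix `A` with realization
`R`, by generators and relations. -/
abbrev KacMoody {n : ℕ} {A : Matrix (Fin n) (Fin n) ℤ} (R : Realization A) : Type :=
  Base R ⧸ serreIdeal R

/-- The image of a generator in the Kac-Moody algebra. -/
def KacMoody.gen {n : ℕ} {A : Matrix (Fin n) (Fin n) ℤ} (R : Realization A) (g : Gen A) :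
    KacMoody R :=
  LieSubmodule.Quotient.mk (Base.gen R g)

/-! ### Roots, braid-equivalence and partial reflection algebras -/

/-- The symmetric bilinear form on the real span of `Π = {α_1, …, α_n}` (in coordinates with
respect to `Π`) given by `(α_i, α_j) = s_i m_{ij}`, so that `(α_i, α_i) = 2 s_i > 0` and
`2 (α_i, α_j) / (α_i, α_i) = m_{ij}`. -/
def form {n : ℕ} (M : Matrix (Fin n) (Fin n) ℤ) (s : Fin n → ℝ) (u v : Fin n → ℝ) : ℝ :=
  ∑ i, ∑ j, u i * (s i * (M i j : ℝ)) * v j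

/-- The reflection `ρ_v(u) = u - 2 (u, v) / (v, v) v`. -/
def reflect {n : ℕ} (M : Matrix (Fin n) (Fin n) ℤ) (s : Fin n → ℝ) (v u : Fin n → ℝ) :
    Fin n → ℝ :=
  u - (2 * form M s u v / form M s v v) • v

/-- The set `Π = {α_1, …, α_n}` in coordinates. -/
def primeRoots (n : ℕ) : Set (Fin n → ℝ) :=
  Set.range fun i => Pi.single i 1

/-- One step `B ↦ (B \ {β}) ∪ {ρ_α(β)}` with `α, β ∈ B` (`α = β` is allowed). -/
def BraidStep {n : ℕ} (M : Matrix (Fin n) (Fin n) ℤ) (s : Fin n → ℝ)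
    (B B' : Set (Fin n → ℝ)) : Prop :=
  ∃ α ∈ B, ∃ β ∈ B, B' = (B \ {β}) ∪ {reflect M s α β}

/-- `B` is a braid-equivalent basis of `M`. -/
def IsBraidBasis {n : ℕ} (M : Matrix (Fin n) (Fin n) ℤ) (s : Fin n → ℝ)
    (B : Set (Fin n → ℝ)) : Prop :=
  Relation.ReflTransGen (BraidStep M s) (primeRoots n) B

/-- The element `∑ v_i α_i` of the dual space of `H`. -/
def Realization.weight {n : ℕ} {M : Matrix (Fin n) (Fin n) ℤ} (R : Realization M)
    (v : Fin n → ℝ) : Module.Dual ℂ (Cartan M) :=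
  ∑ i, (v i : ℂ) • R.root i

/-- Left-hand sides of the remaining defining relations of the partial reflection algebra: one
group for every braid-equivalent basis `B`, all `α, β ∈ B` and all weight vectors `x, y, z` of
weights `α, β, -α`. Since `Base R` is the sum of its weight spaces, the weight vectors of any
quotient of it are exactly the images of the weight vectors of `Base R`, so imposing the relations
on the latter is the same as imposing them on all weight vectors of the quotient. -/
inductive PraRel {n : ℕ} {M : Matrix (Fin n) (Fin n) ℤ} (R : Realization M) (s : Fin n → ℝ) :
    Base R → Prop
  | neg_serre (B : Set (Fin n → ℝ)) (hB : IsBraidBasis M s B) (α β : Fin n → ℝ)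
      (hα : α ∈ B) (hβ : β ∈ B) (hneg : form M s α β < 0) (x y : Base R)
      (hx : IsWeightVector R (R.weight α) x) (hy : IsWeightVector R (R.weight β) y)
      (k : ℕ) (hk : (k : ℝ) = 1 - 2 * form M s α β / form M s α α) :
      PraRel R s (((LieAlgebra.ad ℂ (Base R) x) ^ k) y)
  | neg_comm (B : Set (Fin n → ℝ)) (hB : IsBraidBasis M s B) (α β : Fin n → ℝ)
      (hα : α ∈ B) (hβ : β ∈ B) (hneg : form M s α β < 0) (z y : Base R)
      (hz : IsWeightVector R (-R.weight α) z) (hy : IsWeightVector R (R.weight β) y) :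
      PraRel R s ⁅z, y⁆
  | pos_serre (B : Set (Fin n → ℝ)) (hB : IsBraidBasis M s B) (α β : Fin n → ℝ)
      (hα : α ∈ B) (hβ : β ∈ B) (hpos : 0 < form M s α β) (z y : Base R)
      (hz : IsWeightVector R (-R.weight α) z) (hy : IsWeightVector R (R.weight β) y)
      (k : ℕ) (hk : (k : ℝ) = 1 + 2 * form M s α β / form M s α α) :
      PraRel R s (((LieAlgebra.ad ℂ (Base R) z) ^ k) y)
  | pos_comm (B : Set (Fin n → ℝ)) (hB : IsBraidBasis M s B) (α β : Fin n → ℝ)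
      (hα : α ∈ B) (hβ : β ∈ B) (hpos : 0 < form M s α β) (x y : Base R)
      (hx : IsWeightVector R (R.weight α) x) (hy : IsWeightVector R (R.weight β) y) :
      PraRel R s ⁅x, y⁆
  | zero_comm (B : Set (Fin n → ℝ)) (hB : IsBraidBasis M s B) (α β : Fin n → ℝ)
      (hα : α ∈ B) (hβ : β ∈ B) (hzero : form M s α β = 0) (x y : Base R)
      (hx : IsWeightVector R (R.weight α) x) (hy : IsWeightVector R (R.weight β) y) :
      PraRel R s ⁅x, y⁆
  | zero_comm' (B : Set (Fin n → ℝ)) (hB : IsBraidBasis M s B) (α β : Fin n → ℝ)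
      (hα : α ∈ B) (hβ : β ∈ B) (hzero : form M s α β = 0) (z y : Base R)
      (hz : IsWeightVector R (-R.weight α) z) (hy : IsWeightVector R (R.weight β) y) :
      PraRel R s ⁅z, y⁆

/-- The ideal of `Base R` generated by the relations `PraRel`. -/
def praIdeal {n : ℕ} {M : Matrix (Fin n) (Fin n) ℤ} (R : Realization M) (s : Fin n → ℝ) :
    LieIdeal ℂ (Base R) :=
  LieSubmodule.lieSpan ℂ _ {x | PraRel R s x}

/-- The partial reflection algebra `Pra(M)` of the generalized intersection matrix `M` with
realization `R` and symmetrizer `s`. -/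
abbrev Pra {n : ℕ} {M : Matrix (Fin n) (Fin n) ℤ} (R : Realization M) (s : Fin n → ℝ) : Type :=
  Base R ⧸ praIdeal R s

/-- The image of a generator in `Pra(M)`. -/
def Pra.gen {n : ℕ} {M : Matrix (Fin n) (Fin n) ℤ} (R : Realization M) (s : Fin n → ℝ)
    (g : Gen M) : Pra R s :=
  LieSubmodule.Quotient.mk (Base.gen R g)

end GIM

end

noncomputable section

namespace GIM

/-! ### Operators of an `sl₂`-triple with locally nilpotent raising operator -/

section SlTwo

variable {V : Type*} [AddCommGroup V] [Module ℂ V] {E F T : Module.End ℂ V}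

/-! Both algebras are quotients of algebras with the same kind of basic relations, so the proof
identifies these algebras and then matches two ideals. If `M 0 1 ≤ 0`, then `M` is a generalized
Cartan matrix and the identity of `Base R` serves. If `M 0 1 > 0`, exchanging `e 0` with `f 0` and
negating `α 0` and `h 0` identifies `Base R` with the algebra of a sign-twisted matrix, which is a
generalized Cartan matrix (`exists_twist_equiv`).

The Kac–Moody relations hold in `Pra`: every set `{±α 0, ±α 1}` is a braid basis
(`isBraidBasis_signs`), and for the right signs its relations contain the Serre relations
(`ad_pow_mem_praIdeal`, `lie_mem_praIdeal`).

The converse uses weights alone, so it does not matter which weight vectors enter a relation. In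
rank two every braid basis lies in `{w (±α 0), w (±α 1)}` for one Weyl group element `w`
(`IsBraidBasis.exists_weyl`). Hence each relation of `Pra` has weight `w u`, where `u` is either `±2
α i` or a combination of both simple roots with forbidden signs (`PraRel.exists_isBad`); a
Serre-type relation fits because its weight is a reflection of such a combination.

No nonzero vector of the Kac–Moody algebra has such a weight
(`ChevalleyGenerators.vanish_of_isBad`). That algebra is spanned by the Cartan part and brackets of
the `e i` alone or of the `f i` alone (`triangular_eq_top`), which excludes mixed signs and `±2 α
i`. Vanishing of a weight space passes to its Weyl conjugates by `sl₂`-theory: `ad (e i)` is locally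
nilpotent, so powers of `ad (f i)` are injective on suitable weight spaces
(`eq_zero_of_lower_pow_eq_zero`). When `M 0 1 = 0`, one more reflection turns equal signs into
opposite ones. -/

theorem lower_weight (hTF : T * F - F * T = -(2 : ℂ) • F) {v : V} {l : ℂ} (hv : T v = l • v) :
    T (F v) = (l - 2) • F v := by
  have h := LinearMap.congr_fun hTF v
  simp only [LinearMap.sub_apply, Module.End.mul_apply, LinearMap.smul_apply, hv, map_smul] at h
  rw [sub_eq_iff_eq_add.1 h]
  module

theorem raise_weight (hTE : T * E - E * T = (2 : ℂ) • E) {v : V} {l : ℂ} (hv : T v = l • v) :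
    T (E v) = (l + 2) • E v := by
  have h := LinearMap.congr_fun hTE v
  simp only [LinearMap.sub_apply, Module.End.mul_apply, LinearMap.smul_apply, hv, map_smul] at h
  rw [sub_eq_iff_eq_add.1 h]
  module

theorem raise_lower (hEF : E * F - F * E = T) {v : V} {l : ℂ} (hv : T v = l • v) :
    E (F v) = F (E v) + l • v := by
  have h := LinearMap.congr_fun hEF v
  simp only [LinearMap.sub_apply, Module.End.mul_apply, hv] at h
  rw [← h]; abel

/-- `E` is moved past the `q` outer factors only; the scalar is the sum of the weights `l - 2 j` for
`1 ≤ j ≤ q`. The term `E (F v)` is left alone because `v` need not be a highest weight vector. -/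
theorem raise_lower_pow_succ (hEF : E * F - F * E = T) (hTF : T * F - F * T = -(2 : ℂ) • F)
    (q : ℕ) : ∀ {v : V} {l : ℂ}, T v = l • v →
      E ((F ^ (q + 1)) v) = (F ^ q) (E (F v)) + (q * (l - q - 1)) • (F ^ q) v := by
  induction q with
  | zero => intro v l _; simp
  | succ q ih =>
    intro v l hv
    have hF := lower_weight hTF hv
    have h := ih hF
    rw [pow_succ F (q + 1), Module.End.mul_apply, h, raise_lower hEF hF, map_add, map_smul,
      ← Module.End.mul_apply (F ^ q) F, ← Module.End.mul_apply (F ^ q) F, ← pow_succ]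
    push_cast
    module

/-- In an `sl₂`-module on which `E` is locally nilpotent, `F ^ q` is injective on each weight space
of weight at least `q`. -/
theorem eq_zero_of_lower_pow_eq_zero (hEF : E * F - F * E = T)
    (hTE : T * E - E * T = (2 : ℂ) • E) (hTF : T * F - F * T = -(2 : ℂ) • F)
    (hE : ∀ v, ∃ N : ℕ, (E ^ N) v = 0) (q : ℕ) :
    ∀ {v : V} {l : ℤ}, T v = (l : ℂ) • v → (q : ℤ) ≤ l → (F ^ q) v = 0 → v = 0 := by
  induction q with
  | zero => intro v l _ _ h; simpa using h
  | succ q ih =>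
    intro v l hv hl h0
    have hw : T (E (F v)) = (l : ℂ) • E (F v) := by
      have := raise_weight hTE (lower_weight hTF hv)
      rwa [sub_add_cancel] at this
    have hc := raise_lower_pow_succ hEF hTF q hv
    rw [h0, map_zero] at hc
    -- The induction hypothesis is applied to this combination, which has the weight of `v` and
    -- which `F ^ q` maps to `E (F ^ (q + 1) v) = 0`.
    have h1 : E (F v) + ((q : ℂ) * (l - q - 1)) • v = 0 := by
      refine ih (l := l) ?_ (by push_cast at hl; omega) ?_
      · rw [map_add, hw, map_smul, hv]; module
      · rw [map_add, map_smul, ← hc]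
    -- `F (E v) = E (F v) - l • v`, and the resulting scalar is negative because `l ≥ q + 1`.
    obtain ⟨d, hd, hfe⟩ : ∃ d : ℤ, d < 0 ∧ F (E v) = (d : ℂ) • v := by
      refine ⟨-(q * (l - q - 1)) - l, ?_, ?_⟩
      · have : 0 ≤ (q : ℤ) * (l - q - 1) := mul_nonneg (by positivity) (by push_cast at hl; omega)
        push_cast at hl
        have hq : (0 : ℤ) ≤ q := by positivity
        linarith
      · have := raise_lower hEF hv
        rw [this] at h1
        rw [← sub_eq_zero, ← h1]; push_cast; module
    -- Each step subtracts a positive weight from the scalar, so it never vanishes. Thus `E ^ (k +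
    -- 1) v = 0` forces `E ^ k v = 0`, and local nilpotency descends to `v = 0`.
    have chain : ∀ k : ℕ, T ((E ^ k) v) = ((l + 2 * k : ℤ) : ℂ) • (E ^ k) v ∧
        ∃ d : ℤ, d < 0 ∧ F ((E ^ (k + 1)) v) = (d : ℂ) • (E ^ k) v := by
      intro k
      induction k with
      | zero => exact ⟨by simpa using hv, d, hd, by simpa using hfe⟩
      | succ k ihk =>
        obtain ⟨hT, d, hd, hF⟩ := ihk
        have hT' : T ((E ^ (k + 1)) v) = ((l + 2 * (k + 1 : ℕ) : ℤ) : ℂ) • (E ^ (k + 1)) v := by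
          rw [pow_succ' E, Module.End.mul_apply, raise_weight hTE hT]
          push_cast; module
        refine ⟨hT', d - (l + 2 * (k + 1 : ℕ)), by push_cast at hl ⊢; omega, ?_⟩
        have h2 := raise_lower hEF hT'
        rw [hF, map_smul, ← Module.End.mul_apply E, ← pow_succ'] at h2
        rw [pow_succ' E (k + 1), Module.End.mul_apply, ← sub_eq_zero]
        rw [← sub_eq_zero] at h2
        rw [← neg_eq_zero, ← h2]
        push_cast; module
    obtain ⟨N, hN⟩ := hE v
    have down : ∀ N : ℕ, (E ^ N) v = 0 → v = 0 := by
      intro N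
      induction N with
      | zero => intro h; simpa using h
      | succ N ihN =>
        intro h
        obtain ⟨-, d, hd, hF⟩ := chain N
        rw [h, map_zero] at hF
        exact ihN ((smul_eq_zero.1 hF.symm).resolve_left (by exact_mod_cast hd.ne))
    exact down N hN

end SlTwo

/-! ### Chevalley generators in rank two and the triangular spanning set -/

/-- `e`, `f` and `h` generate `L` and satisfy the defining relations of the Kac-Moody algebra of the
rank two generalized Cartan matrix `A` with roots `a` and coroots `c`. -/
structure ChevalleyGenerators {H L : Type*} [AddCommGroup H] [Module ℂ H] [LieRing L]
    [LieAlgebra ℂ L] (A : Matrix (Fin 2) (Fin 2) ℤ) (a : Fin 2 → Module.Dual ℂ H) (c : Fin 2 → H)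
    (h : H →ₗ[ℂ] L) (e f : Fin 2 → L) : Prop where
  diag : ∀ i, A i i = 2
  root_coroot : ∀ i j, a i (c j) = (A j i : ℂ)
  h_h : ∀ x y, ⁅h x, h y⁆ = 0
  h_e : ∀ x i, ⁅h x, e i⁆ = a i x • e i
  h_f : ∀ x i, ⁅h x, f i⁆ = -(a i x • f i)
  e_f : ∀ i, ⁅e i, f i⁆ = h (c i)
  e_f_ne : ∀ i j, i ≠ j → ⁅e i, f j⁆ = 0
  serre_e : ∀ i j, i ≠ j → ((LieAlgebra.ad ℂ L (e i)) ^ (1 - A i j).toNat) (e j) = 0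
  serre_f : ∀ i j, i ≠ j → ((LieAlgebra.ad ℂ L (f i)) ^ (1 - A i j).toNat) (f j) = 0
  generate : ∀ K : LieSubalgebra ℂ L, (∀ x, h x ∈ K) → (∀ i, e i ∈ K) → (∀ i, f i ∈ K) → K = ⊤

/-- Right-normed brackets of the elements `e i`, with their degrees. -/
inductive RootWord {L : Type*} [LieRing L] (e : Fin 2 → L) : (Fin 2 → ℕ) → L → Prop
  | gen (i : Fin 2) : RootWord e (Pi.single i 1) (e i)
  | lie (i : Fin 2) {d : Fin 2 → ℕ} {x : L} (hx : RootWord e d x) :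
      RootWord e (d + Pi.single i 1) ⁅e i, x⁆

/-- Since `⁅e i, e i⁆ = 0`, a nonzero bracket of length at least two must involve both generators.
-/
theorem RootWord.degree {L : Type*} [LieRing L] {e : Fin 2 → L} {d : Fin 2 → ℕ} {x : L}
    (hx : RootWord e d x) :
    (∀ i, 1 ≤ d i) ∨ (∃ i, d = Pi.single i 1 ∧ x = e i) ∨ x = 0 := by
  induction hx with
  | gen i => exact Or.inr (Or.inl ⟨i, rfl, rfl⟩)
  | lie i hx ih =>
    rcases ih with ih | ⟨j, rfl, rfl⟩ | rfl
    · exact Or.inl fun j => (ih j).trans (by simp)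
    · by_cases hij : i = j
      · subst hij; simp
      · left
        intro k
        fin_cases i <;> fin_cases j <;> fin_cases k <;> simp_all
    · simp

/-- The span of the right-normed brackets of the `e i`. -/
def wordSpan {L : Type*} [LieRing L] [LieAlgebra ℂ L] (e : Fin 2 → L) : Submodule ℂ L :=
  Submodule.span ℂ {x | ∃ d, RootWord e d x}

namespace ChevalleyGenerators

variable {H L : Type*} [AddCommGroup H] [Module ℂ H] [LieRing L] [LieAlgebra ℂ L]
  {A : Matrix (Fin 2) (Fin 2) ℤ} {a : Fin 2 → Module.Dual ℂ H} {c : Fin 2 → H}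
  {h : H →ₗ[ℂ] L} {e f : Fin 2 → L}

/-- The symmetry of the Chevalley involution: it transfers each statement about the `e i` to the `f
i`. -/
theorem swap (G : ChevalleyGenerators A a c h e f) : ChevalleyGenerators A a c (-h) f e where
  diag := G.diag
  root_coroot := G.root_coroot
  h_h x y := by simp [G.h_h]
  h_e x i := by simp [G.h_f]
  h_f x i := by simp [G.h_e]
  e_f i := by rw [← lie_skew, G.e_f]; rfl
  e_f_ne i j hij := by rw [← lie_skew, G.e_f_ne j i hij.symm, neg_zero]
  serre_e := G.serre_f
  serre_f := G.serre_e
  generate K hh he hf := G.generate K (fun x => by simpa using hh x) hf he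

theorem lie_word (G : ChevalleyGenerators A a c h e f) (t : H) {d : Fin 2 → ℕ} {x : L}
    (hx : RootWord e d x) : ⁅h t, x⁆ = ((d 0 : ℂ) * a 0 t + d 1 * a 1 t) • x := by
  induction hx with
  | gen i => rw [G.h_e]; fin_cases i <;> simp
  | @lie i d x hx ih =>
    rw [leibniz_lie, G.h_e, ih, smul_lie, lie_smul, ← add_smul]
    congr 1
    fin_cases i <;> simp <;> ring

theorem lie_wordSpan (e : Fin 2 → L) (i : Fin 2) {x : L} (hx : x ∈ wordSpan e) :
    ⁅e i, x⁆ ∈ wordSpan e := by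
  induction hx using Submodule.span_induction with
  | mem x hx => obtain ⟨d, hx⟩ := hx; exact Submodule.subset_span ⟨_, hx.lie i⟩
  | zero => simp
  | add x y _ _ hx hy => rw [lie_add]; exact add_mem hx hy
  | smul r x _ hx => rw [lie_smul]; exact Submodule.smul_mem _ _ hx

theorem h_lie_wordSpan (G : ChevalleyGenerators A a c h e f) (t : H) {x : L}
    (hx : x ∈ wordSpan e) : ⁅h t, x⁆ ∈ wordSpan e := by
  induction hx using Submodule.span_induction with
  | mem x hx =>
    obtain ⟨d, hx⟩ := hx
    rw [G.lie_word t hx]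
    exact Submodule.smul_mem _ _ (Submodule.subset_span ⟨_, hx⟩)
  | zero => simp
  | add x y _ _ hx hy => rw [lie_add]; exact add_mem hx hy
  | smul r x _ hx => rw [lie_smul]; exact Submodule.smul_mem _ _ hx

/-- By the Leibniz rule `f i` meets one letter at a time and turns it into a Cartan element or zero.
A Cartan term survives only from a single letter. -/
theorem f_lie_wordSpan (G : ChevalleyGenerators A a c h e f) (i : Fin 2) {x : L}
    (hx : x ∈ wordSpan e) : ⁅f i, x⁆ ∈ wordSpan e ⊔ LinearMap.range h := by
  induction hx using Submodule.span_induction with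
  | mem x hx =>
    obtain ⟨d, hx⟩ := hx
    induction hx with
    | gen j =>
      by_cases hij : j = i
      · subst hij
        rw [← lie_skew, G.e_f, ← map_neg]
        exact Submodule.mem_sup_right ⟨_, rfl⟩
      · rw [← lie_skew, G.e_f_ne j i hij]; simp
    | @lie j d x hx ih =>
      rw [leibniz_lie]
      refine add_mem (Submodule.mem_sup_left ?_) (Submodule.mem_sup_left ?_)
      · have hx' : x ∈ wordSpan e := Submodule.subset_span ⟨_, hx⟩
        by_cases hij : j = i
        · subst hij
          rw [← lie_skew (f j), G.e_f, neg_lie]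
          exact neg_mem (G.h_lie_wordSpan _ hx')
        · rw [← lie_skew (f i), G.e_f_ne j i hij]; simp
      · obtain ⟨y, hy, z, ⟨t, rfl⟩, hyz⟩ := Submodule.mem_sup.1 ih
        rw [← hyz, lie_add, ← lie_skew (e j) (h t), G.h_e]
        refine add_mem (lie_wordSpan e j hy) (neg_mem (Submodule.smul_mem _ _ ?_))
        exact Submodule.subset_span ⟨_, RootWord.gen j⟩
  | zero => simp
  | add x y _ _ hx hy => rw [lie_add]; exact add_mem hx hy
  | smul r x _ hx => rw [lie_smul]; exact Submodule.smul_mem _ _ hx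

theorem range_neg (h : H →ₗ[ℂ] L) : LinearMap.range (-h) = LinearMap.range h := by
  ext x
  exact ⟨fun ⟨y, hy⟩ => ⟨-y, by simpa using hy⟩, fun ⟨y, hy⟩ => ⟨-y, by simpa using hy⟩⟩

/-- The span of `H` and of the brackets of the `e i` and of the `f i`. -/
def triangular (h : H →ₗ[ℂ] L) (e f : Fin 2 → L) : Submodule ℂ L :=
  (wordSpan e ⊔ LinearMap.range h) ⊔ wordSpan f

theorem triangular_swap : triangular (-h) f e = triangular h e f := by
  rw [triangular, triangular, range_neg, sup_comm, sup_assoc, sup_comm (wordSpan f)]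

theorem mem_triangular {x : L} : x ∈ triangular h e f ↔
    ∃ y ∈ wordSpan e, ∃ t, ∃ z ∈ wordSpan f, y + h t + z = x := by
  constructor
  · intro hx
    obtain ⟨w, hw, z, hz, rfl⟩ := Submodule.mem_sup.1 hx
    obtain ⟨y, hy, _, ⟨t, rfl⟩, rfl⟩ := Submodule.mem_sup.1 hw
    exact ⟨y, hy, t, z, hz, rfl⟩
  · rintro ⟨y, hy, t, z, hz, rfl⟩
    exact add_mem (Submodule.mem_sup_left (add_mem (Submodule.mem_sup_left hy)
      (Submodule.mem_sup_right ⟨t, rfl⟩))) (Submodule.mem_sup_right hz)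

theorem e_lie_triangular (G : ChevalleyGenerators A a c h e f) (i : Fin 2) {x : L}
    (hx : x ∈ triangular h e f) : ⁅e i, x⁆ ∈ triangular h e f := by
  obtain ⟨y, hy, t, z, hz, rfl⟩ := mem_triangular.1 hx
  rw [lie_add, lie_add, ← lie_skew (e i) (h t), G.h_e]
  refine add_mem (add_mem ?_ ?_) ?_
  · exact Submodule.mem_sup_left (Submodule.mem_sup_left (lie_wordSpan e i hy))
  · exact Submodule.mem_sup_left (Submodule.mem_sup_left
      (neg_mem (Submodule.smul_mem _ _ (Submodule.subset_span ⟨_, RootWord.gen i⟩))))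
  · have := G.swap.f_lie_wordSpan i hz
    rw [← triangular_swap]
    exact Submodule.mem_sup_left this

theorem h_lie_triangular (G : ChevalleyGenerators A a c h e f) (s : H) {x : L}
    (hx : x ∈ triangular h e f) : ⁅h s, x⁆ ∈ triangular h e f := by
  obtain ⟨y, hy, t, z, hz, rfl⟩ := mem_triangular.1 hx
  rw [lie_add, lie_add, G.h_h, add_zero]
  refine add_mem ?_ ?_
  · exact Submodule.mem_sup_left (Submodule.mem_sup_left (G.h_lie_wordSpan s hy))
  · have := G.swap.h_lie_wordSpan (-s) hz
    simp only [LinearMap.neg_apply, map_neg, neg_neg] at this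
    exact Submodule.mem_sup_right this

/-- The subspace is stable under bracketing with all generators. Only spanning is needed later, not
directness of the sum. -/
theorem triangular_eq_top (G : ChevalleyGenerators A a c h e f) : triangular h e f = ⊤ := by
  -- By the Jacobi identity the elements of the subspace whose adjoint action preserves it form a
  -- subalgebra, and it contains the generators.
  let K : LieSubalgebra ℂ L :=
    { carrier := {x | x ∈ triangular h e f ∧ ∀ y ∈ triangular h e f, ⁅x, y⁆ ∈ triangular h e f}
      zero_mem' := ⟨zero_mem _, by simp⟩
      add_mem' := fun hx hy => ⟨add_mem hx.1 hy.1, fun z hz => by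
        rw [add_lie]; exact add_mem (hx.2 z hz) (hy.2 z hz)⟩
      smul_mem' := fun r x hx => ⟨Submodule.smul_mem _ r hx.1, fun z hz => by
        rw [smul_lie]; exact Submodule.smul_mem _ r (hx.2 z hz)⟩
      lie_mem' := fun {x y} hx hy => ⟨hx.2 y hy.1, fun z hz => by
        rw [lie_lie]; exact sub_mem (hx.2 _ (hy.2 z hz)) (hy.2 _ (hx.2 z hz))⟩ }
  have hK : K = ⊤ := by
    refine G.generate K ?_ ?_ ?_
    · exact fun x => ⟨mem_triangular.2 ⟨0, zero_mem _, x, 0, zero_mem _, by simp⟩,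
        fun y hy => G.h_lie_triangular x hy⟩
    · exact fun i => ⟨mem_triangular.2 ⟨e i, Submodule.subset_span ⟨_, RootWord.gen i⟩, 0, 0,
        zero_mem _, by simp⟩, fun y hy => G.e_lie_triangular i hy⟩
    · refine fun i => ⟨mem_triangular.2 ⟨0, zero_mem _, 0, f i,
        Submodule.subset_span ⟨_, RootWord.gen i⟩, by simp⟩, fun y hy => ?_⟩
      rw [← triangular_swap] at hy ⊢
      exact G.swap.e_lie_triangular i hy
  rw [eq_top_iff]
  intro x _
  have : x ∈ K := hK ▸ LieSubalgebra.mem_top x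
  exact this.1

/-! ### Degrees with zero weight space -/

/-- Degrees which are not roots or zero because of their signs or since they are `±2 αᵢ`. -/
def IsNonRoot (u : Fin 2 → ℤ) : Prop :=
  u 0 * u 1 < 0 ∨ ∃ i, u = Pi.single i 2 ∨ u = Pi.single i (-2)

theorem IsNonRoot.neg {u : Fin 2 → ℤ} (hu : IsNonRoot u) : IsNonRoot (-u) := by
  rcases hu with hu | ⟨i, rfl | rfl⟩
  · left; simpa using hu
  · right; exact ⟨i, Or.inr (Pi.single_neg i _).symm⟩
  · right; exact ⟨i, Or.inl (by rw [← Pi.single_neg]; rfl)⟩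

theorem IsNonRoot.ne_zero {u : Fin 2 → ℤ} (hu : IsNonRoot u) : u ≠ 0 := by
  rintro rfl
  rcases hu with hu | ⟨i, hu | hu⟩
  · simp at hu
  · simpa using congrFun hu i
  · simpa using congrFun hu i

theorem gaussian_injective {u v : Fin 2 → ℤ}
    (huv : (u 0 : ℂ) + u 1 * Complex.I = v 0 + v 1 * Complex.I) : u = v := by
  have h0 := congrArg Complex.re huv
  have h1 := congrArg Complex.im huv
  simp at h0 h1
  ext i
  fin_cases i
  · exact_mod_cast h0
  · exact_mod_cast h1

/-- The element `t` takes the values `1` and `I` on the two roots, so its eigenvalues are Gaussian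
integers that determine the degree. A nonzero word never has degree `u`, so its eigenvalue differs.
-/
theorem wordSpan_le_iSup_eigenspace (G : ChevalleyGenerators A a c h e f) {t : H} (h0 : a 0 t = 1)
    (h1 : a 1 t = Complex.I) {u : Fin 2 → ℤ} (hu : IsNonRoot u) :
    wordSpan e ≤ ⨆ j, ⨆ (_ : j ≠ (u 0 : ℂ) + u 1 * Complex.I),
      (LieAlgebra.ad ℂ L (h t)).eigenspace j := by
  refine Submodule.span_le.2 ?_
  rintro x ⟨d, hx⟩
  by_cases hx0 : x = 0
  · subst hx0; exact zero_mem _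
  refine Submodule.mem_iSup_of_mem ((d 0 : ℂ) + d 1 * Complex.I) ?_
  refine Submodule.mem_iSup_of_mem ?_ ?_
  · intro heq
    have hd : (fun i => (d i : ℤ)) = u := gaussian_injective (by push_cast; exact heq)
    subst hd
    rcases hu with hu | ⟨i, hu⟩
    · exact absurd hu (not_lt.2 (by positivity))
    · rcases hx.degree with hd | ⟨j, rfl, rfl⟩ | rfl
      -- `i + 1` is the other index of `Fin 2`, at which `u` vanishes.
      · have hi := hd (i + 1)
        have : ((d (i + 1) : ℕ) : ℤ) = 0 := by
          rcases hu with hu | hu <;>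
          · have := congrFun hu (i + 1)
            rwa [Pi.single_eq_of_ne (by fin_cases i <;> decide)] at this
        omega
      · rcases hu with hu | hu <;>
        · have := congrFun hu i
          simp only [Pi.single_apply] at this
          split_ifs at this <;> simp at this
      · exact hx0 rfl
  · rw [Module.End.mem_eigenspace_iff, LieAlgebra.ad_apply, G.lie_word t hx, h0, h1, mul_one]

/-- The remaining eigenspaces of `ad (h t)` already span `L`, and eigenspaces are independent. -/
theorem eq_zero_of_isNonRoot (G : ChevalleyGenerators A a c h e f) {t : H} (h0 : a 0 t = 1)
    (h1 : a 1 t = Complex.I) {u : Fin 2 → ℤ} (hu : IsNonRoot u) {v : L}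
    (hv : ⁅h t, v⁆ = ((u 0 : ℂ) * a 0 t + u 1 * a 1 t) • v) : v = 0 := by
  have hind := (LieAlgebra.ad ℂ L (h t)).eigenspaces_iSupIndep ((u 0 : ℂ) + u 1 * Complex.I)
  have htop : (⨆ j, ⨆ (_ : j ≠ (u 0 : ℂ) + u 1 * Complex.I),
      (LieAlgebra.ad ℂ L (h t)).eigenspace j) = ⊤ := by
    rw [eq_top_iff, ← G.triangular_eq_top]
    refine sup_le (sup_le (G.wordSpan_le_iSup_eigenspace h0 h1 hu) ?_) ?_
    · rintro _ ⟨x, rfl⟩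
      refine Submodule.mem_iSup_of_mem 0 (Submodule.mem_iSup_of_mem ?_ ?_)
      · intro h
        exact hu.ne_zero (gaussian_injective (v := 0) (by simpa using h.symm))
      · simp [G.h_h]
    · refine (G.swap.wordSpan_le_iSup_eigenspace h0 h1 hu.neg).trans ?_
      refine iSup_le fun j => iSup_le fun hj => ?_
      intro x hx
      refine Submodule.mem_iSup_of_mem (-j) (Submodule.mem_iSup_of_mem ?_ ?_)
      · rintro h
        apply hj
        rw [← neg_neg j, h]
        simp; ring
      · rw [Module.End.mem_eigenspace_iff] at hx ⊢
        simp only [LinearMap.neg_apply, map_neg, LieAlgebra.ad_apply] at hx ⊢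
        rw [neg_smul, ← hx, neg_neg]
  rw [htop, disjoint_top] at hind
  have : v ∈ (LieAlgebra.ad ℂ L (h t)).eigenspace ((u 0 : ℂ) + u 1 * Complex.I) := by
    rw [Module.End.mem_eigenspace_iff, LieAlgebra.ad_apply, hv, h0, h1, mul_one]
  rwa [hind, Submodule.mem_bot] at this

/-! ### Local nilpotency and reflections -/

/-- The vectors killed by a power of `ad (e i)` form the Engel subalgebra, so it suffices to test
generators; for `e j` with `j ≠ i` this is the Serre relation. -/
theorem ad_e_locally_nilpotent (G : ChevalleyGenerators A a c h e f) (i : Fin 2) (v : L) :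
    ∃ N : ℕ, ((LieAlgebra.ad ℂ L (e i)) ^ N) v = 0 := by
  rw [← LieSubalgebra.mem_engel_iff]
  have hh : ∀ x, h x ∈ LieSubalgebra.engel ℂ (e i) := by
    intro x
    rw [LieSubalgebra.mem_engel_iff]
    refine ⟨2, ?_⟩
    rw [pow_two, Module.End.mul_apply, LieAlgebra.ad_apply, LieAlgebra.ad_apply,
      ← lie_skew (e i) (h x), G.h_e]
    simp
  have : LieSubalgebra.engel ℂ (e i) = ⊤ := by
    refine G.generate _ hh ?_ ?_
    · intro j
      by_cases hij : i = j
      · subst hij; exact LieSubalgebra.self_mem_engel ℂ _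
      · rw [LieSubalgebra.mem_engel_iff]
        exact ⟨_, G.serre_e i j hij⟩
    · intro j
      by_cases hij : i = j
      · subst hij
        obtain ⟨n, hn⟩ := (LieSubalgebra.mem_engel_iff _ _ _).1 (hh (c i))
        rw [LieSubalgebra.mem_engel_iff]
        refine ⟨n + 1, ?_⟩
        rw [pow_succ, Module.End.mul_apply, LieAlgebra.ad_apply, G.e_f, hn]
      · rw [LieSubalgebra.mem_engel_iff]
        exact ⟨1, by simp [G.e_f_ne i j hij]⟩
  rw [this]
  exact LieSubalgebra.mem_top v

theorem lie_pow_f_weight (G : ChevalleyGenerators A a c h e f) (i : Fin 2) {χ : Module.Dual ℂ H}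
    {v : L} (hv : ∀ x, ⁅h x, v⁆ = χ x • v) (k : ℕ) (x : H) :
    ⁅h x, ((LieAlgebra.ad ℂ L (f i)) ^ k) v⁆ =
      (χ x - k * a i x) • ((LieAlgebra.ad ℂ L (f i)) ^ k) v := by
  induction k with
  | zero => simpa using hv x
  | succ k ih =>
    rw [pow_succ', Module.End.mul_apply, LieAlgebra.ad_apply, leibniz_lie, G.h_f, ih, neg_lie,
      smul_lie, lie_smul]
    push_cast; module

/-- `ad (f i) ^ m` maps the weight space of `χ` injectively into that of `χ - m • a i`, which is the
reflected weight because `m = χ (c i)`. -/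
theorem eq_zero_of_lower (G : ChevalleyGenerators A a c h e f) (i : Fin 2) {χ : Module.Dual ℂ H}
    {m : ℕ} (hm : χ (c i) = m)
    (hχ : ∀ v : L, (∀ x, ⁅h x, v⁆ = (χ - (m : ℂ) • a i) x • v) → v = 0)
    {v : L} (hv : ∀ x, ⁅h x, v⁆ = χ x • v) : v = 0 := by
  have hac : a i (c i) = 2 := by rw [G.root_coroot, G.diag]; simp
  refine eq_zero_of_lower_pow_eq_zero (E := LieAlgebra.ad ℂ L (e i)) (F := LieAlgebra.ad ℂ L (f i))
    (T := LieAlgebra.ad ℂ L (h (c i))) ?_ ?_ ?_ (G.ad_e_locally_nilpotent i) m (v := v) (l := m)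
    ?_ le_rfl ?_
  · ext w
    rw [← G.e_f]
    exact (lie_lie _ _ w).symm
  · ext w
    have := lie_lie (h (c i)) (e i) w
    rw [G.h_e, hac, smul_lie] at this
    exact this.symm
  · ext w
    have := lie_lie (h (c i)) (f i) w
    rw [G.h_f, hac, neg_lie, smul_lie, ← neg_smul] at this
    exact this.symm
  · simpa [hm] using hv (c i)
  · apply hχ
    intro x
    rw [G.lie_pow_f_weight i hv]
    simp

/-- Vanishing of weight spaces is invariant under simple reflections. -/
theorem eq_zero_of_reflect (G : ChevalleyGenerators A a c h e f) (i : Fin 2) {χ : Module.Dual ℂ H}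
    {m : ℤ} (hm : χ (c i) = m)
    (hχ : ∀ v : L, (∀ x, ⁅h x, v⁆ = (χ - (m : ℂ) • a i) x • v) → v = 0)
    {v : L} (hv : ∀ x, ⁅h x, v⁆ = χ x • v) : v = 0 := by
  obtain ⟨k, rfl | rfl⟩ := Int.eq_nat_or_neg m
  · exact G.eq_zero_of_lower i (by simpa using hm) (by simpa using hχ) hv
  -- For a nonpositive pairing `e` and `f` change roles; the Cartan part then acts through `-h`, so
  -- weights change sign.
  · refine G.swap.eq_zero_of_lower i (χ := -χ) (m := k) (by simp [hm]) ?_ ?_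
    · intro w hw
      apply hχ
      intro x
      have := hw x
      simp only [LinearMap.neg_apply, neg_lie, LinearMap.sub_apply, LinearMap.smul_apply] at this ⊢
      rw [neg_eq_iff_eq_neg] at this
      rw [this, ← neg_smul]
      congr 1
      simp; ring
    · intro x
      simp [hv]

end ChevalleyGenerators

/-! ### The Weyl group and braid-equivalent bases -/

section Braid

variable {M : Matrix (Fin 2) (Fin 2) ℤ} {s : Fin 2 → ℝ}

/-- The simple reflection `u ↦ u - u(h_i) α_i` in coordinates with respect to the simple roots. -/
def simpleReflection (M : Matrix (Fin 2) (Fin 2) ℤ) (i : Fin 2) : Module.End ℤ (Fin 2 → ℤ) :=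
  LinearMap.id - (LinearMap.proj i ∘ₗ M.mulVecLin).smulRight (Pi.single i 1)

theorem simpleReflection_apply (i : Fin 2) (u : Fin 2 → ℤ) :
    simpleReflection M i u = u - (M i 0 * u 0 + M i 1 * u 1) • Pi.single i 1 := by
  simp [simpleReflection, Matrix.mulVec, dotProduct, Fin.sum_univ_two]

/-- The Weyl group, as a monoid of endomorphisms of the root lattice. -/
def weyl (M : Matrix (Fin 2) (Fin 2) ℤ) : Submonoid (Module.End ℤ (Fin 2 → ℤ)) :=
  Submonoid.closure (Set.range (simpleReflection M))

theorem simpleReflection_mem (i : Fin 2) : simpleReflection M i ∈ weyl M :=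
  Submonoid.subset_closure ⟨i, rfl⟩

/-- Inclusion of the root lattice into its real span. -/
def realVec (u : Fin 2 → ℤ) : Fin 2 → ℝ := fun i => (u i : ℝ)

theorem IsSymmetrizer.comm (hs : IsSymmetrizer M s) :
    s 1 * (M 1 0 : ℝ) = s 0 * (M 0 1 : ℝ) := by
  have h := congrFun (congrFun hs.symm 0) 1
  simpa [Matrix.diagonal_mul] using h

theorem form_realVec (hM : IsGIM M) (u v : Fin 2 → ℤ) :
    form M s (realVec u) (realVec v) = 2 * s 0 * (u 0 * v 0) + s 0 * M 0 1 * (u 0 * v 1) +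
      s 1 * M 1 0 * (u 1 * v 0) + 2 * s 1 * (u 1 * v 1) := by
  simp only [form, realVec, Fin.sum_univ_two, hM.diag]
  push_cast; ring

theorem form_simpleReflection (hM : IsGIM M) (hs : IsSymmetrizer M s) (i : Fin 2)
    (u v : Fin 2 → ℤ) :
    form M s (realVec (simpleReflection M i u)) (realVec (simpleReflection M i v)) =
      form M s (realVec u) (realVec v) := by
  have hb := hs.comm
  rw [form_realVec hM, form_realVec hM]
  simp only [simpleReflection_apply]
  fin_cases i
  · simp [hM.diag]
    linear_combination (-2 * (u 1 : ℝ) * v 0 - M 0 1 * u 1 * v 1) * hb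
  · simp [hM.diag]
    linear_combination -(-2 * (u 0 : ℝ) * v 1 - M 1 0 * u 0 * v 0) * hb

theorem form_weyl (hM : IsGIM M) (hs : IsSymmetrizer M s) {w : Module.End ℤ (Fin 2 → ℤ)}
    (hw : w ∈ weyl M) : ∀ u v : Fin 2 → ℤ,
      form M s (realVec (w u)) (realVec (w v)) = form M s (realVec u) (realVec v) := by
  induction hw using Submonoid.closure_induction with
  | mem w hw => obtain ⟨i, rfl⟩ := hw; exact form_simpleReflection hM hs i
  | one => intro u v; rfl
  | mul w w' _ _ h h' => intro u v; rw [Module.End.mul_apply, Module.End.mul_apply, h, h']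

theorem form_smul_single (hM : IsGIM M) (hs : IsSymmetrizer M s) (i : Fin 2) (a : ℤ)
    (u : Fin 2 → ℤ) : form M s (realVec u) (realVec (a • Pi.single i 1)) =
      a * s i * (M i 0 * u 0 + M i 1 * u 1) := by
  have hb := hs.comm
  rw [form_realVec hM]
  fin_cases i
  · simp [hM.diag]; linear_combination (u 1 : ℝ) * a * hb
  · simp [hM.diag]; linear_combination -(u 0 : ℝ) * a * hb

theorem form_single_self (hM : IsGIM M) (hs : IsSymmetrizer M s) {i : Fin 2} {a : ℤ}
    (ha : a = 1 ∨ a = -1) : form M s (realVec (a • Pi.single i 1)) (realVec (a • Pi.single i 1)) =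
      2 * s i := by
  rw [form_smul_single hM hs]
  fin_cases i <;> rcases ha with rfl | rfl <;> simp [hM.diag] <;> ring

theorem form_single_single (hM : IsGIM M) (hs : IsSymmetrizer M s) (i j : Fin 2) (a b : ℤ) :
    form M s (realVec (a • Pi.single i 1)) (realVec (b • Pi.single j 1)) =
      s i * ((a * b * M i j : ℤ) : ℝ) := by
  have hb := hs.comm
  rw [form_realVec hM]
  fin_cases i <;> fin_cases j <;> simp [hM.diag] <;> ring

/-- `w` preserves the form and hence intertwines reflections; the sign `a` cancels because a
reflection depends only on the line of its root. -/
theorem reflect_weyl (hM : IsGIM M) (hs : IsSymmetrizer M s) {w : Module.End ℤ (Fin 2 → ℤ)}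
    (hw : w ∈ weyl M) (i : Fin 2) {a : ℤ} (ha : a = 1 ∨ a = -1) (u : Fin 2 → ℤ) :
    reflect M s (realVec (w (a • Pi.single i 1))) (realVec (w u)) =
      realVec (w (simpleReflection M i u)) := by
  have hc : 2 * form M s (realVec (w u)) (realVec (w (a • Pi.single i 1))) /
      form M s (realVec (w (a • Pi.single i 1))) (realVec (w (a • Pi.single i 1))) =
      ((a * (M i 0 * u 0 + M i 1 * u 1) : ℤ) : ℝ) := by
    have := hs.pos i
    rw [form_weyl hM hs hw, form_weyl hM hs hw, form_single_self hM hs ha,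
      form_smul_single hM hs]
    push_cast
    field_simp
  rw [reflect, hc, simpleReflection_apply, map_sub, map_smul, map_smul]
  ext k
  rcases ha with rfl | rfl <;> simp [realVec]
  ring

/-- Each braid step either flips one sign or multiplies `w` on the right by a simple reflection and
flips one sign. Rank two is essential: besides the replaced root at most the reflecting root
remains. -/
theorem IsBraidBasis.exists_weyl (hM : IsGIM M) (hs : IsSymmetrizer M s) {B : Set (Fin 2 → ℝ)}
    (hB : IsBraidBasis M s B) : ∃ w ∈ weyl M, ∃ η : Fin 2 → ℤ, (∀ i, η i = 1 ∨ η i = -1) ∧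
      ∀ b ∈ B, ∃ i, b = realVec (w (η i • Pi.single i 1)) := by
  induction hB with
  | refl =>
    refine ⟨1, one_mem _, fun _ => 1, fun _ => Or.inl rfl, ?_⟩
    rintro _ ⟨i, rfl⟩
    refine ⟨i, ?_⟩
    ext k
    by_cases hk : k = i
    · subst hk; simp [realVec]
    · simp [realVec, hk]
  | tail _ hstep ih =>
    obtain ⟨w, hw, η, hη, h⟩ := ih
    obtain ⟨α, hα, β, hβ, rfl⟩ := hstep
    obtain ⟨i, rfl⟩ := h α hα
    obtain ⟨j, rfl⟩ := h β hβ
    have hη' : ∀ k, Function.update η i (-η i) k = 1 ∨ Function.update η i (-η i) k = -1 := by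
      intro k
      by_cases hk : k = i
      · subst hk; have := hη k; simp; omega
      · simpa [hk] using hη k
    have hflip : simpleReflection M i (-η i • Pi.single i 1) = η i • Pi.single i 1 := by
      rw [simpleReflection_apply]
      ext k
      fin_cases i <;> simp [hM.diag, Pi.single_apply] <;> ring_nf <;> split_ifs <;> ring
    by_cases hij : j = i
    · subst hij
      refine ⟨w, hw, _, hη', ?_⟩
      rintro b (⟨hb, hb'⟩ | rfl)
      · obtain ⟨k, rfl⟩ := h b hb
        refine ⟨k, ?_⟩
        rw [Function.update_of_ne]
        rintro rfl
        exact hb' rfl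
      · refine ⟨j, ?_⟩
        rw [reflect_weyl hM hs hw j (hη j), Function.update_self]
        congr 2
        rw [← neg_neg (simpleReflection M j _), ← map_neg, ← neg_smul, hflip, neg_smul]
    -- The reflecting root stays fixed although `w` acquires the factor `simpleReflection M i`;
    -- flipping `η i` compensates.
    · refine ⟨w * simpleReflection M i, mul_mem hw (simpleReflection_mem i), _, hη', ?_⟩
      rintro b (⟨hb, hb'⟩ | rfl)
      · obtain ⟨k, rfl⟩ := h b hb
        have hk : k = i := by
          have : k ≠ j := by rintro rfl; exact hb' rfl
          fin_cases i <;> fin_cases j <;> fin_cases k <;> simp_all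
        subst hk
        refine ⟨k, ?_⟩
        rw [Function.update_self, Module.End.mul_apply, hflip]
      · refine ⟨j, ?_⟩
        rw [reflect_weyl hM hs hw i (hη i), Function.update_of_ne hij]
        rfl

/-- `B = {±α_1, ±α_2}` is braid-equivalent to `Π`. -/
theorem isBraidBasis_signs (hM : IsGIM M) (hs : IsSymmetrizer M s) {η : Fin 2 → ℤ}
    (hη : ∀ i, η i = 1 ∨ η i = -1) :
    ∃ B, IsBraidBasis M s B ∧ ∀ i, realVec (η i • Pi.single i 1) ∈ B := by
  have hflip : ∀ i, ∀ B : Set (Fin 2 → ℝ), ∀ η : Fin 2 → ℤ, (∀ i, η i = 1 ∨ η i = -1) →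
      IsBraidBasis M s B → (∀ i, realVec (η i • Pi.single i 1) ∈ B) →
      ∃ B', IsBraidBasis M s B' ∧ realVec (-η i • Pi.single i 1) ∈ B' ∧
        ∀ j, j ≠ i → realVec (η j • Pi.single j 1) ∈ B' := by
    intro i B η hη hB h
    -- The step with `α = β` replaces a root by its negative.
    refine ⟨_, hB.tail ⟨_, h i, _, h i, rfl⟩, Or.inr ?_, fun j hj => Or.inl ⟨h j, ?_⟩⟩
    · have := reflect_weyl hM hs (one_mem _) i (hη i) (η i • Pi.single i 1)
      rw [Module.End.one_apply, Module.End.one_apply] at this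
      rw [Set.mem_singleton_iff, this, simpleReflection_apply]
      congr 1
      ext k
      fin_cases i <;> simp [hM.diag, Pi.single_apply] <;> split_ifs <;> ring
    · intro heq
      have := congrFun (Set.mem_singleton_iff.1 heq) j
      rcases hη j with h | h <;> simp [realVec, h, hj] at this
  have h0 : ∀ i : Fin 2, realVec ((1 : ℤ) • Pi.single i 1) ∈ primeRoots 2 := by
    intro i
    refine ⟨i, ?_⟩
    ext k
    by_cases hk : k = i
    · subst hk; simp [realVec]
    · simp [realVec, hk]
  obtain ⟨B, hB, hB'⟩ : ∃ B, IsBraidBasis M s B ∧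
      ∀ i, realVec ((if i = 0 then η 0 else 1) • Pi.single i 1) ∈ B := by
    rcases hη 0 with h | h
    · exact ⟨_, Relation.ReflTransGen.refl, fun i => by simpa [h] using h0 i⟩
    · obtain ⟨B, hB, h1, h2⟩ := hflip 0 _ (fun _ => 1) (fun _ => Or.inl rfl)
        Relation.ReflTransGen.refl h0
      refine ⟨B, hB, fun i => ?_⟩
      by_cases hi : i = 0
      · subst hi; simpa [h] using h1
      · simpa [hi] using h2 i hi
  rcases hη 1 with h | h
  · refine ⟨B, hB, fun i => ?_⟩
    have := hB' i
    fin_cases i <;> simpa [h] using this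
  · obtain ⟨B, hB, h1, h2⟩ := hflip 1 _ (fun i => if i = 0 then η 0 else 1)
      (fun i => by have := hη 0; split_ifs <;> simp_all) hB hB'
    refine ⟨B, hB, fun i => ?_⟩
    by_cases hi : i = 1
    · subst hi; simpa [h] using h1
    · have := h2 i hi
      fin_cases i
      · simpa using this
      · exact absurd rfl hi

end Braid

/-! ### Weights in the root lattice -/

section Weights

variable {M : Matrix (Fin 2) (Fin 2) ℤ} {R : Realization M}

/-- The weight `∑ u_i α_i` for `u` in the root lattice. -/
def Realization.latticeWeight (R : Realization M) : (Fin 2 → ℤ) →+ Module.Dual ℂ (Cartan M) where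
  toFun u := ∑ i, (u i : ℂ) • R.root i
  map_zero' := by simp
  map_add' u v := by simp [add_smul, Finset.sum_add_distrib]

theorem Realization.weight_realVec (R : Realization M) (u : Fin 2 → ℤ) :
    R.weight (realVec u) = R.latticeWeight u := by
  simp [Realization.weight, Realization.latticeWeight, realVec]

theorem Realization.latticeWeight_apply (R : Realization M) (u : Fin 2 → ℤ) (x : Cartan M) :
    R.latticeWeight u x = u 0 * R.root 0 x + u 1 * R.root 1 x := by
  simp [Realization.latticeWeight, Fin.sum_univ_two]

theorem Realization.latticeWeight_single (R : Realization M) (a : ℤ) (i : Fin 2) :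
    R.latticeWeight (a • Pi.single i 1) = (a : ℂ) • R.root i := by
  refine LinearMap.ext fun x => ?_
  rw [Realization.latticeWeight_apply]
  fin_cases i <;> simp

theorem IsWeightVector.lie {χ ψ : Module.Dual ℂ (Cartan M)} {x y : Base R}
    (hx : IsWeightVector R χ x) (hy : IsWeightVector R ψ y) :
    IsWeightVector R (χ + ψ) ⁅x, y⁆ := by
  intro t
  rw [leibniz_lie, hx, hy, smul_lie, lie_smul, LinearMap.add_apply, add_smul]

theorem IsWeightVector.ad_pow {χ ψ : Module.Dual ℂ (Cartan M)} {x y : Base R}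
    (hx : IsWeightVector R χ x) (hy : IsWeightVector R ψ y) (k : ℕ) :
    IsWeightVector R (k • χ + ψ) (((LieAlgebra.ad ℂ (Base R) x) ^ k) y) := by
  induction k with
  | zero => simpa using hy
  | succ k ih =>
    rw [pow_succ', Module.End.mul_apply, LieAlgebra.ad_apply, succ_nsmul', add_assoc]
    exact hx.lie ih

/-- Elements of the root lattice which turn out not to be weights of `Pra(M)`. -/
def IsBad (M : Matrix (Fin 2) (Fin 2) ℤ) (u : Fin 2 → ℤ) : Prop :=
  0 < M 0 1 * (u 0 * u 1) ∨ (M 0 1 = 0 ∧ u 0 * u 1 ≠ 0) ∨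
    ∃ i, u = Pi.single i 2 ∨ u = Pi.single i (-2)

theorem isBad_pair {i j : Fin 2} (hij : i ≠ j) {a b : ℤ}
    (h : 0 < M 0 1 * (a * b) ∨ (M 0 1 = 0 ∧ a * b ≠ 0)) :
    IsBad M (a • Pi.single i 1 + b • Pi.single j 1) := by
  have key : (a • Pi.single i (1 : ℤ) + b • Pi.single j 1 : Fin 2 → ℤ) 0 *
      (a • Pi.single i (1 : ℤ) + b • Pi.single j 1 : Fin 2 → ℤ) 1 = a * b := by
    fin_cases i <;> fin_cases j <;> simp_all [mul_comm]
  rw [IsBad, key]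
  tauto

theorem isBad_double (i : Fin 2) {a : ℤ} (ha : a = 1 ∨ a = -1) :
    IsBad M (a • Pi.single i 1 + a • Pi.single i 1) := by
  refine Or.inr (Or.inr ⟨i, ?_⟩)
  rw [← Pi.single_smul, ← Pi.single_add]
  rcases ha with rfl | rfl <;> simp

end Weights

/-! ### Presentations and their Chevalley generators -/

section Presentation

variable {n : ℕ} {M : Matrix (Fin n) (Fin n) ℤ} (R : Realization M)

theorem Base.mk_eq_zero {x : FreeLieAlgebra ℂ (Gen M)} (hx : BaseRel R x) :
    (LieSubmodule.Quotient.mk x : Base R) = 0 :=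
  LieSubmodule.Quotient.mk_eq_zero'.2 (LieSubmodule.subset_lieSpan hx)

/-- The map from `H` to the Lie algebra defined by the basic relations. -/
def Base.cartan : Cartan M →ₗ[ℂ] Base R where
  toFun x := Base.gen R (Gen.h x)
  map_add' x y := sub_eq_zero.1 (Base.mk_eq_zero R (BaseRel.h_add x y))
  map_smul' r x := sub_eq_zero.1 (Base.mk_eq_zero R (BaseRel.h_smul r x))

theorem Base.cartan_lie_cartan (x y : Cartan M) : ⁅Base.cartan R x, Base.cartan R y⁆ = 0 :=
  Base.mk_eq_zero R (BaseRel.h_h x y)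

theorem Base.e_lie_f (i : Fin n) : ⁅Base.gen R (Gen.e i), Base.gen R (Gen.f i)⁆ =
    Base.cartan R (coroot M i) :=
  sub_eq_zero.1 (Base.mk_eq_zero R (BaseRel.e_f i))

theorem Base.cartan_lie_e (x : Cartan M) (i : Fin n) :
    ⁅Base.cartan R x, Base.gen R (Gen.e i)⁆ = R.root i x • Base.gen R (Gen.e i) :=
  sub_eq_zero.1 (Base.mk_eq_zero R (BaseRel.h_e x i))

theorem Base.cartan_lie_f (x : Cartan M) (i : Fin n) :
    ⁅Base.cartan R x, Base.gen R (Gen.f i)⁆ = -(R.root i x • Base.gen R (Gen.f i)) :=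
  eq_neg_of_add_eq_zero_left (Base.mk_eq_zero R (BaseRel.h_f x i))

theorem freeLieAlgebra_generate {X : Type*} (K : LieSubalgebra ℂ (FreeLieAlgebra ℂ X))
    (hK : ∀ x, FreeLieAlgebra.of ℂ x ∈ K) (y : FreeLieAlgebra ℂ X) : y ∈ K := by
  have : K.incl.comp (FreeLieAlgebra.lift ℂ fun x => (⟨_, hK x⟩ : K)) = LieHom.id := by
    ext x
    simp
  rw [← LieHom.id_apply (R := ℂ) y, ← this]
  exact Subtype.property _

theorem Base.generate (K : LieSubalgebra ℂ (Base R)) (hK : ∀ g, Base.gen R g ∈ K) : K = ⊤ := by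
  rw [eq_top_iff]
  intro y _
  obtain ⟨y, rfl⟩ := LieSubmodule.Quotient.surjective_mk' _ y
  exact freeLieAlgebra_generate
    (K.comap ({ LieSubmodule.Quotient.mk' (baseIdeal R) with map_lie' := rfl } :
      FreeLieAlgebra ℂ (Gen M) →ₗ⁅ℂ⁆ Base R)) hK y

/-- The quotient map onto the Kac-Moody algebra. -/
def KacMoody.proj : Base R →ₗ⁅ℂ⁆ KacMoody R :=
  { LieSubmodule.Quotient.mk' (serreIdeal R) with map_lie' := rfl }

theorem KacMoody.proj_surjective : Function.Surjective (KacMoody.proj R) :=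
  LieSubmodule.Quotient.surjective_mk' _

theorem KacMoody.proj_eq_zero {x : Base R} : KacMoody.proj R x = 0 ↔ x ∈ serreIdeal R :=
  LieSubmodule.Quotient.mk_eq_zero'

theorem KacMoody.proj_eq_zero_of_rel {x : Base R} (hx : SerreRel R x) : KacMoody.proj R x = 0 :=
  (KacMoody.proj_eq_zero R).2 (LieSubmodule.subset_lieSpan hx)

theorem ad_pow_map {L L' : Type*} [LieRing L] [LieAlgebra ℂ L] [LieRing L'] [LieAlgebra ℂ L']
    (φ : L →ₗ⁅ℂ⁆ L') (x y : L) (k : ℕ) :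
    φ (((LieAlgebra.ad ℂ L x) ^ k) y) = ((LieAlgebra.ad ℂ L' (φ x)) ^ k) (φ y) := by
  induction k with
  | zero => rfl
  | succ k ih => rw [pow_succ', pow_succ', Module.End.mul_apply, Module.End.mul_apply,
      LieAlgebra.ad_apply, LieAlgebra.ad_apply, LieHom.map_lie, ih]

theorem KacMoody.chevalleyGenerators {A : Matrix (Fin 2) (Fin 2) ℤ} (RA : Realization A)
    (hA : ∀ i, A i i = 2) :
    ChevalleyGenerators A RA.root (coroot A) ((KacMoody.proj RA : Base RA →ₗ[ℂ] KacMoody RA) ∘ₗ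
      Base.cartan RA) (fun i => KacMoody.proj RA (Base.gen RA (Gen.e i)))
      (fun i => KacMoody.proj RA (Base.gen RA (Gen.f i))) where
  diag := hA
  root_coroot := RA.root_coroot
  h_h x y := by
    have := congrArg (KacMoody.proj RA) (Base.cartan_lie_cartan RA x y)
    rwa [LieHom.map_lie, map_zero] at this
  h_e x i := by
    have := congrArg (KacMoody.proj RA) (Base.cartan_lie_e RA x i)
    rwa [LieHom.map_lie, map_smul] at this
  h_f x i := by
    have := congrArg (KacMoody.proj RA) (Base.cartan_lie_f RA x i)
    rwa [LieHom.map_lie, map_neg, map_smul] at this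
  e_f i := by
    have := congrArg (KacMoody.proj RA) (Base.e_lie_f RA i)
    rwa [LieHom.map_lie] at this
  e_f_ne i j hij := by
    rw [← LieHom.map_lie]
    exact KacMoody.proj_eq_zero_of_rel RA (SerreRel.e_f i j hij)
  serre_e i j hij := by
    rw [← ad_pow_map]
    exact KacMoody.proj_eq_zero_of_rel RA (SerreRel.serre_e i j hij)
  serre_f i j hij := by
    rw [← ad_pow_map]
    exact KacMoody.proj_eq_zero_of_rel RA (SerreRel.serre_f i j hij)
  generate K hh he hf := by
    have hK : K.comap (KacMoody.proj RA) = ⊤ := by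
      refine Base.generate RA _ ?_
      rintro (i | i | x)
      · exact he i
      · exact hf i
      · exact hh x
    rw [eq_top_iff]
    intro y _
    obtain ⟨y, rfl⟩ := KacMoody.proj_surjective RA y
    have : y ∈ K.comap (KacMoody.proj RA) := hK ▸ LieSubalgebra.mem_top y
    exact this

end Presentation

/-- Lets the Cartan space of `M` act on the Kac–Moody algebra of the twisted matrix, so that weights
on both sides live in one dual space. -/
theorem ChevalleyGenerators.comp {H H' L : Type*} [AddCommGroup H] [Module ℂ H] [AddCommGroup H']
    [Module ℂ H'] [LieRing L] [LieAlgebra ℂ L] {A : Matrix (Fin 2) (Fin 2) ℤ}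
    {a : Fin 2 → Module.Dual ℂ H} {c : Fin 2 → H} {h : H →ₗ[ℂ] L} {e f : Fin 2 → L}
    (G : ChevalleyGenerators A a c h e f) (ψ : H' ≃ₗ[ℂ] H) {a' : Fin 2 → Module.Dual ℂ H'}
    {c' : Fin 2 → H'} (ha : ∀ i x, a i (ψ x) = a' i x) (hc : ∀ i, ψ (c' i) = c i) :
    ChevalleyGenerators A a' c' (h ∘ₗ ψ) e f where
  diag := G.diag
  root_coroot i j := by rw [← ha, hc, G.root_coroot]
  h_h x y := G.h_h _ _
  h_e x i := by rw [← ha]; exact G.h_e _ _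
  h_f x i := by rw [← ha]; exact G.h_f _ _
  e_f i := by rw [G.e_f, ← hc]; rfl
  e_f_ne := G.e_f_ne
  serre_e := G.serre_e
  serre_f := G.serre_f
  generate K hh he hf := G.generate K (fun x => by simpa using hh (ψ.symm x)) he hf

/-! ### Vanishing of the weight spaces conjugate to bad weights -/

section Vanishing

variable {M : Matrix (Fin 2) (Fin 2) ℤ} {R : Realization M}

theorem simpleReflection_involutive (hM : IsGIM M) (i : Fin 2) (u : Fin 2 → ℤ) :
    simpleReflection M i (simpleReflection M i u) = u := by
  simp only [simpleReflection_apply]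
  ext k
  fin_cases i <;> fin_cases k <;> simp [hM.diag] <;> ring

theorem latticeWeight_simpleReflection (i : Fin 2) (u : Fin 2 → ℤ) :
    R.latticeWeight (simpleReflection M i u) =
      R.latticeWeight u - ((M i 0 * u 0 + M i 1 * u 1 : ℤ) : ℂ) • R.root i := by
  rw [simpleReflection_apply, map_sub, Realization.latticeWeight_single]

theorem exists_root_values (R : Realization M) (z : Fin 2 → ℂ) : ∃ t, ∀ i, R.root i t = z i := by
  have hli : LinearIndependent ℂ (fun i x => R.root i x) :=
    R.linearIndependent.map' (LinearMap.ltoFun ℂ (Cartan M) ℂ ℂ)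
      (LinearMap.ker_eq_bot.2 DFunLike.coe_injective)
  have hspan := span_flip_eq_top_iff_linearIndependent.2 hli
  have : (LinearMap.range (LinearMap.pi R.root)) = ⊤ := by
    rw [eq_top_iff, ← hspan, Submodule.span_le]
    rintro _ ⟨x, rfl⟩
    exact ⟨x, rfl⟩
  obtain ⟨t, ht⟩ := LinearMap.range_eq_top.1 this z
  exact ⟨t, fun i => congrFun ht i⟩

variable {A : Matrix (Fin 2) (Fin 2) ℤ} {L : Type*} [LieRing L] [LieAlgebra ℂ L] {ε : Fin 2 → ℤ}
  {h : Cartan M →ₗ[ℂ] L} {e f : Fin 2 → L}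

/-- Negating a root together with its coroot does not change the reflection, so the reflections of
`M` serve for the twisted generators. -/
theorem ChevalleyGenerators.vanish_reflect (hε : ∀ i, ε i = 1 ∨ ε i = -1)
    (G : ChevalleyGenerators A (fun i => (ε i : ℂ) • R.root i) (fun i => (ε i : ℂ) • coroot M i)
      h e f) (i : Fin 2) {u : Fin 2 → ℤ}
    (hu : ∀ v : L, (∀ x, ⁅h x, v⁆ = R.latticeWeight (simpleReflection M i u) x • v) → v = 0)
    {v : L} (hv : ∀ x, ⁅h x, v⁆ = R.latticeWeight u x • v) : v = 0 := by
  refine G.eq_zero_of_reflect i (m := ε i * (M i 0 * u 0 + M i 1 * u 1)) ?_ ?_ hv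
  · rw [R.latticeWeight_apply, map_smul, map_smul, R.root_coroot, R.root_coroot]
    push_cast
    simp only [smul_eq_mul]
    ring
  · intro v hv
    apply hu
    intro x
    rw [hv, latticeWeight_simpleReflection, smul_smul]
    congr 4
    rcases hε i with h | h <;> rw [h] <;> push_cast <;> ring

theorem ChevalleyGenerators.vanish_of_isBad (hM : IsGIM M) (hε : ∀ i, ε i = 1 ∨ ε i = -1)
    (hsign : ε 0 * ε 1 * M 0 1 ≤ 0)
    (G : ChevalleyGenerators A (fun i => (ε i : ℂ) • R.root i) (fun i => (ε i : ℂ) • coroot M i)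
      h e f) {w : Module.End ℤ (Fin 2 → ℤ)} (hw : w ∈ weyl M) {u : Fin 2 → ℤ} (hu : IsBad M u) :
    ∀ v : L, (∀ x, ⁅h x, v⁆ = R.latticeWeight (w u) x • v) → v = 0 := by
  induction hw using Submonoid.closure_induction_left with
  | mul_left x hx w _ ih =>
    obtain ⟨i, rfl⟩ := hx
    intro v hv
    refine G.vanish_reflect hε i ?_ hv
    intro v hv
    rw [Module.End.mul_apply, simpleReflection_involutive hM] at hv
    exact ih v hv
  | one =>
    -- The factor `ε i` makes the twisted roots `ε i • R.root i` take the values `1` and `I`.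
    obtain ⟨t, ht⟩ := exists_root_values R (fun i => (ε i : ℂ) * if i = 0 then 1 else Complex.I)
    have hε2 : ∀ i, (ε i : ℂ) * ε i = 1 := by
      intro i
      rcases hε i with h | h <;> rw [h] <;> simp
    have base : ∀ u : Fin 2 → ℤ, ChevalleyGenerators.IsNonRoot (fun i => ε i * u i) → ∀ v : L,
        (∀ x, ⁅h x, v⁆ = R.latticeWeight u x • v) → v = 0 := by
      intro u hu v hv
      refine G.eq_zero_of_isNonRoot (t := t) ?_ ?_ hu ?_
      · simp [ht, hε2]
      · simp [ht, ← mul_assoc, hε2]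
      · rw [hv, R.latticeWeight_apply]
        congr 1
        simp only [LinearMap.smul_apply, smul_eq_mul]
        push_cast
        linear_combination (-(u 0 : ℂ) * R.root 0 t) * hε2 0 - (u 1 * R.root 1 t) * hε2 1
    rw [Module.End.one_apply]
    have hneg : ∀ u : Fin 2 → ℤ, (ε 0 * u 0) * (ε 1 * u 1) < 0 → ∀ v : L,
        (∀ x, ⁅h x, v⁆ = R.latticeWeight u x • v) → v = 0 := fun u hu => base u (Or.inl hu)
    rcases hu with hu | ⟨h0, hu⟩ | ⟨i, hu⟩
    · apply hneg
      by_contra hcon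
      rcases hε 0 with h | h <;> rcases hε 1 with h' | h' <;> rw [h, h'] at hsign hcon <;> nlinarith
    · rcases lt_or_gt_of_ne (show (ε 0 * u 0) * (ε 1 * u 1) ≠ 0 by
        have := hε 0; have := hε 1
        have : ε 0 ≠ 0 := by omega
        have : ε 1 ≠ 0 := by omega
        have := left_ne_zero_of_mul hu; have := right_ne_zero_of_mul hu
        positivity) with h | h
      · exact hneg u h
      -- Here `M 0 1 = 0` and the signs agree: reflecting in `α 0` only negates `u 0`, which makes
      -- them opposite.
      · intro v hv
        refine G.vanish_reflect hε 0 (hneg _ ?_) hv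
        rw [simpleReflection_apply]
        simp [hM.diag, h0]
        linarith
    · apply base
      refine Or.inr ⟨i, ?_⟩
      have key : ∀ c : ℤ, (fun k => ε k * (Pi.single i c : Fin 2 → ℤ) k) =
          Pi.single i (ε i * c) := by
        intro c
        ext k
        by_cases hk : k = i
        · subst hk; simp
        · simp [hk]
      rcases hu with rfl | rfl <;> rw [key] <;> rcases hε i with h | h <;> rw [h] <;> simp

end Vanishing

/-! ### Weights of the relations of `Pra`, and the Serre relations among them -/

section Relations

variable {M : Matrix (Fin 2) (Fin 2) ℤ} {s : Fin 2 → ℝ} {R : Realization M}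

theorem form_braid (hM : IsGIM M) (hs : IsSymmetrizer M s) {w : Module.End ℤ (Fin 2 → ℤ)}
    (hw : w ∈ weyl M) (i j : Fin 2) (a b : ℤ) :
    form M s (realVec (w (a • Pi.single i 1))) (realVec (w (b • Pi.single j 1))) =
      s i * ((a * b * M i j : ℤ) : ℝ) := by
  rw [form_weyl hM hs hw, form_single_single hM hs]

theorem two_form_div_form (hM : IsGIM M) (hs : IsSymmetrizer M s) {w : Module.End ℤ (Fin 2 → ℤ)}
    (hw : w ∈ weyl M) (i j : Fin 2) {a : ℤ} (ha : a = 1 ∨ a = -1) (b : ℤ) :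
    2 * form M s (realVec (w (a • Pi.single i 1))) (realVec (w (b • Pi.single j 1))) /
      form M s (realVec (w (a • Pi.single i 1))) (realVec (w (a • Pi.single i 1))) =
      ((a * b * M i j : ℤ) : ℝ) := by
  have := hs.pos i
  rw [form_braid hM hs hw, form_weyl hM hs hw, form_single_self hM hs ha]
  field_simp

theorem simpleReflection_pair (hM : IsGIM M) {i j : Fin 2} (a b : ℤ) :
    simpleReflection M i (a • Pi.single i 1 + b • Pi.single j 1) =
      (-a - b * M i j) • Pi.single i 1 + b • Pi.single j 1 := by
  rw [simpleReflection_apply]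
  ext k
  fin_cases i <;> fin_cases j <;> fin_cases k <;> simp [hM.diag] <;> ring

theorem isBad_of_pos (hM : IsGIM M) {i j : Fin 2} (hij : i ≠ j) {a b : ℤ}
    (h : 0 < a * b * M i j) : IsBad M (a • Pi.single i 1 + b • Pi.single j 1) := by
  refine isBad_pair hij (Or.inl ?_)
  rw [mul_comm]
  have key : 0 < a * b * M i j → 0 < a * b * M j i := by
    intro h
    have hn := hM.neg_iff i j hij
    have hp := hM.pos_iff i j hij
    rcases pos_and_pos_or_neg_and_neg_of_mul_pos h with ⟨h1, h2⟩ | ⟨h1, h2⟩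
    · exact mul_pos h1 (hp.1 h2)
    · exact mul_pos_of_neg_of_neg h1 (hn.1 h2)
  fin_cases i <;> fin_cases j
  · exact absurd rfl hij
  · exact h
  · exact key h
  · exact absurd rfl hij

theorem isBad_of_eq_zero (hM : IsGIM M) {i j : Fin 2} (hij : i ≠ j) {a b : ℤ} (hab : a * b ≠ 0)
    (h : M i j = 0) : IsBad M (a • Pi.single i 1 + b • Pi.single j 1) := by
  refine isBad_pair hij (Or.inr ⟨?_, hab⟩)
  have h0 := hM.neg_iff i j hij
  have h1 := hM.pos_iff i j hij
  have : M j i = 0 := by omega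
  fin_cases i <;> fin_cases j <;> simp_all

/-- The defining relations of `Pra(M)` live in weights which are Weyl conjugates of bad ones. -/
theorem PraRel.exists_isBad (hM : IsGIM M) (hs : IsSymmetrizer M s) {x : Base R}
    (hx : PraRel R s x) : ∃ w ∈ weyl M, ∃ u, IsBad M u ∧
      IsWeightVector R (R.latticeWeight (w u)) x := by
  have main : ∀ {B : Set (Fin 2 → ℝ)}, IsBraidBasis M s B → ∀ {α β : Fin 2 → ℝ}, α ∈ B → β ∈ B →
      ∃ w ∈ weyl M, ∃ (i j : Fin 2) (a b : ℤ), (a = 1 ∨ a = -1) ∧ (b = 1 ∨ b = -1) ∧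
        (i = j → a = b) ∧ α = realVec (w (a • Pi.single i 1)) ∧
        β = realVec (w (b • Pi.single j 1)) := by
    intro B hB α β hα hβ
    obtain ⟨w, hw, η, hη, h⟩ := hB.exists_weyl hM hs
    obtain ⟨i, hi⟩ := h α hα
    obtain ⟨j, hj⟩ := h β hβ
    exact ⟨w, hw, i, j, η i, η j, hη i, hη j, fun h => by rw [h], hi, hj⟩
  have sq : ∀ {a : ℤ}, (a = 1 ∨ a = -1) → a * a = 1 := by
    rintro a (rfl | rfl) <;> rfl
  have ne : ∀ {a : ℤ}, (a = 1 ∨ a = -1) → a ≠ 0 := by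
    rintro a (rfl | rfl) <;> decide
  induction hx with
  | neg_serre B hB α β hα hβ hneg x y hx hy k hk =>
    obtain ⟨w, hw, i, j, a, b, ha, hb, hab, rfl, rfl⟩ := main hB hα hβ
    rw [two_form_div_form hM hs hw i j ha] at hk
    rw [form_braid hM hs hw, ← smul_eq_mul, smul_neg_iff_of_pos_left (hs.pos i),
      Int.cast_lt_zero] at hneg
    have hij : i ≠ j := by
      rintro rfl
      rw [← hab rfl, sq ha, hM.diag] at hneg
      omega
    have hk' : (k : ℤ) = 1 - a * b * M i j := by exact_mod_cast hk
    -- With `k = 1 - a b M i j` and `a² = 1`, the weight `k α + β` is the reflection in `α` of `β -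
    -- α`, and `β - α` has bad signs.
    refine ⟨w * simpleReflection M i, mul_mem hw (simpleReflection_mem i), _,
      isBad_of_pos (a := -a) (b := b) hM hij (by linarith), ?_⟩
    have := hx.ad_pow hy k
    rw [R.weight_realVec, R.weight_realVec, ← map_nsmul, ← map_add, ← map_nsmul, ← map_add] at this
    rw [Module.End.mul_apply, simpleReflection_pair hM]
    convert this using 4
    rw [← natCast_zsmul, smul_smul, hk']
    congr 1
    linear_combination (b * M i j) * sq ha
  | neg_comm B hB α β hα hβ hneg z y hz hy =>
    obtain ⟨w, hw, i, j, a, b, ha, hb, hab, rfl, rfl⟩ := main hB hα hβ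
    rw [form_braid hM hs hw, ← smul_eq_mul, smul_neg_iff_of_pos_left (hs.pos i),
      Int.cast_lt_zero] at hneg
    have hij : i ≠ j := by
      rintro rfl
      rw [← hab rfl, sq ha, hM.diag] at hneg
      omega
    refine ⟨w, hw, _, isBad_of_pos (a := -a) (b := b) hM hij (by linarith), ?_⟩
    have := hz.lie hy
    rw [R.weight_realVec, R.weight_realVec, ← map_neg, ← map_add, ← map_neg, ← map_add] at this
    rwa [neg_smul]
  | pos_serre B hB α β hα hβ hpos z y hz hy k hk =>
    obtain ⟨w, hw, i, j, a, b, ha, hb, hab, rfl, rfl⟩ := main hB hα hβ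
    rw [two_form_div_form hM hs hw i j ha] at hk
    rw [form_braid hM hs hw, mul_pos_iff_of_pos_left (hs.pos i), Int.cast_pos] at hpos
    have hk' : (k : ℤ) = 1 + a * b * M i j := by exact_mod_cast hk
    have := hz.ad_pow hy k
    rw [R.weight_realVec, R.weight_realVec, ← map_neg, ← map_nsmul, ← map_add, ← map_neg,
      ← map_nsmul, ← map_add] at this
    -- For `α = β` the exponent is `3`, and the relation has weight `-3 α + α = -2 α`.
    by_cases hij : i = j
    · subst hij
      obtain rfl := hab rfl
      have ha' : -a = 1 ∨ -a = -1 := by omega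
      refine ⟨w, hw, _, isBad_double i ha', ?_⟩
      convert this using 3
      rw [← natCast_zsmul, hk', sq ha, hM.diag, ← add_smul, ← neg_smul, smul_smul, ← add_smul]
      congr 1
      ring
    · refine ⟨w * simpleReflection M i, mul_mem hw (simpleReflection_mem i), _,
        isBad_of_pos (a := a) (b := b) hM hij hpos, ?_⟩
      rw [Module.End.mul_apply, simpleReflection_pair hM]
      convert this using 4
      rw [← natCast_zsmul, ← neg_smul, smul_smul, hk']
      congr 1
      linear_combination (b * M i j) * sq ha
  | pos_comm B hB α β hα hβ hpos x y hx hy =>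
    obtain ⟨w, hw, i, j, a, b, ha, hb, hab, rfl, rfl⟩ := main hB hα hβ
    rw [form_braid hM hs hw, mul_pos_iff_of_pos_left (hs.pos i), Int.cast_pos] at hpos
    have := hx.lie hy
    rw [R.weight_realVec, R.weight_realVec, ← map_add, ← map_add] at this
    refine ⟨w, hw, _, ?_, this⟩
    by_cases hij : i = j
    · subst hij
      obtain rfl := hab rfl
      exact isBad_double i ha
    · exact isBad_of_pos hM hij hpos
  | zero_comm B hB α β hα hβ hzero x y hx hy =>
    obtain ⟨w, hw, i, j, a, b, ha, hb, hab, rfl, rfl⟩ := main hB hα hβ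
    rw [form_braid hM hs hw] at hzero
    have hMij : M i j = 0 := by
      have := (mul_eq_zero.1 hzero).resolve_left (hs.pos i).ne'
      exact (mul_eq_zero.1 (Int.cast_eq_zero.1 this)).resolve_left (mul_ne_zero (ne ha) (ne hb))
    have hij : i ≠ j := by
      rintro rfl
      rw [hM.diag] at hMij
      omega
    have := hx.lie hy
    rw [R.weight_realVec, R.weight_realVec, ← map_add, ← map_add] at this
    exact ⟨w, hw, _, isBad_of_eq_zero hM hij (mul_ne_zero (ne ha) (ne hb)) hMij, this⟩
  | zero_comm' B hB α β hα hβ hzero z y hz hy =>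
    obtain ⟨w, hw, i, j, a, b, ha, hb, hab, rfl, rfl⟩ := main hB hα hβ
    rw [form_braid hM hs hw] at hzero
    have hMij : M i j = 0 := by
      have := (mul_eq_zero.1 hzero).resolve_left (hs.pos i).ne'
      exact (mul_eq_zero.1 (Int.cast_eq_zero.1 this)).resolve_left (mul_ne_zero (ne ha) (ne hb))
    have hij : i ≠ j := by
      rintro rfl
      rw [hM.diag] at hMij
      omega
    have := hz.lie hy
    rw [R.weight_realVec, R.weight_realVec, ← map_neg, ← map_add, ← map_neg, ← map_add,
      ← neg_smul] at this
    exact ⟨w, hw, _, isBad_of_eq_zero hM hij (mul_ne_zero (neg_ne_zero.2 (ne ha)) (ne hb)) hMij,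
      this⟩

/-- A defining relation for the braid basis with signs `η`. When the product is zero the exponent is
`1`, and the orthogonality relation takes the place of the Serre relation. -/
theorem ad_pow_mem_praIdeal (hM : IsGIM M) (hs : IsSymmetrizer M s) {η : Fin 2 → ℤ}
    (hη : ∀ i, η i = 1 ∨ η i = -1) {i j : Fin 2} (hsign : η i * η j * M i j ≤ 0)
    {x y : Base R} (hx : IsWeightVector R (R.latticeWeight (η i • Pi.single i 1)) x)
    (hy : IsWeightVector R (R.latticeWeight (η j • Pi.single j 1)) y) :
    ((LieAlgebra.ad ℂ (Base R) x) ^ (1 - η i * η j * M i j).toNat) y ∈ praIdeal R s := by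
  obtain ⟨B, hB, hmem⟩ := isBraidBasis_signs hM hs hη
  have hform := form_braid hM hs (one_mem _) i j (η i) (η j)
  have hdiv := two_form_div_form hM hs (one_mem _) i j (hη i) (η j)
  simp only [Module.End.one_apply] at hform hdiv
  rw [← R.weight_realVec] at hx hy
  apply LieSubmodule.subset_lieSpan
  rcases hsign.lt_or_eq with hneg | hzero
  · refine PraRel.neg_serre B hB _ _ (hmem i) (hmem j) ?_ x y hx hy _ ?_
    · rw [hform]
      exact mul_neg_of_pos_of_neg (hs.pos i) (Int.cast_lt_zero.2 hneg)
    · rw [hdiv]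
      have : (((1 - η i * η j * M i j).toNat : ℤ) : ℝ) = ((1 - η i * η j * M i j : ℤ) : ℝ) := by
        rw [Int.toNat_of_nonneg (by omega)]
      push_cast at this ⊢
      exact this
  · rw [hzero]
    exact PraRel.zero_comm B hB _ _ (hmem i) (hmem j) (by rw [hform, hzero]; simp) x y hx hy

theorem lie_mem_praIdeal (hM : IsGIM M) (hs : IsSymmetrizer M s) {η : Fin 2 → ℤ}
    (hη : ∀ i, η i = 1 ∨ η i = -1) {i j : Fin 2} (hsign : η i * η j * M i j ≤ 0)
    {z y : Base R} (hz : IsWeightVector R (R.latticeWeight (-η i • Pi.single i 1)) z)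
    (hy : IsWeightVector R (R.latticeWeight (η j • Pi.single j 1)) y) :
    ⁅z, y⁆ ∈ praIdeal R s := by
  obtain ⟨B, hB, hmem⟩ := isBraidBasis_signs hM hs hη
  have hform := form_braid hM hs (one_mem _) i j (η i) (η j)
  simp only [Module.End.one_apply] at hform
  rw [neg_smul, map_neg, ← R.weight_realVec] at hz
  rw [← R.weight_realVec] at hy
  apply LieSubmodule.subset_lieSpan
  rcases hsign.lt_or_eq with hneg | hzero
  · refine PraRel.neg_comm B hB _ _ (hmem i) (hmem j) ?_ z y hz hy
    rw [hform]
    exact mul_neg_of_pos_of_neg (hs.pos i) (Int.cast_lt_zero.2 hneg)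
  · exact PraRel.zero_comm' B hB _ _ (hmem i) (hmem j) (by rw [hform, hzero]; simp) z y hz hy

end Relations

/-! ### Matching the two ideals -/

section Comparison

variable {M A : Matrix (Fin 2) (Fin 2) ℤ} {s : Fin 2 → ℝ} {R : Realization M} {RA : Realization A}
  {ε : Fin 2 → ℤ} {Φ : Base R ≃ₗ⁅ℂ⁆ Base RA} {ψ : Cartan M ≃ₗ[ℂ] Cartan A}

/-- Each generator of `praIdeal R s` has a weight `w u` with `u` bad, and its image in the Kac–Moody
algebra keeps that weight, so the image is zero. -/
theorem map_mem_serreIdeal (hM : IsGIM M) (hs : IsSymmetrizer M s)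
    (hε : ∀ i, ε i = 1 ∨ ε i = -1) (hA : ∀ i j, A i j = ε i * ε j * M i j) (hsign : A 0 1 ≤ 0)
    (hΦ : ∀ x, Φ (Base.cartan R x) = Base.cartan RA (ψ x))
    (hroot : ∀ i x, RA.root i (ψ x) = ε i * R.root i x)
    (hcoroot : ∀ i, ψ (coroot M i) = (ε i : ℂ) • coroot A i) {x : Base R}
    (hx : x ∈ praIdeal R s) : Φ x ∈ serreIdeal RA := by
  have hε2 : ∀ i, ε i * ε i = 1 := by
    intro i
    rcases hε i with h | h <;> rw [h] <;> simp
  have G := (KacMoody.chevalleyGenerators RA (fun i => by rw [hA, hε2, hM.diag, one_mul])).comp ψ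
    (a' := fun i => (ε i : ℂ) • R.root i) (c' := fun i => (ε i : ℂ) • coroot M i)
    (fun i x => by rw [hroot]; rfl)
    (fun i => by
      have : (ε i : ℂ) * ε i = 1 := by exact_mod_cast hε2 i
      rw [map_smul, hcoroot, smul_smul, this, one_smul])
  have hle : praIdeal R s ≤ ((KacMoody.proj RA).comp Φ.toLieHom).ker := by
    refine LieSubmodule.lieSpan_le.2 fun y hy => ?_
    obtain ⟨w, hw, u, hu, hy⟩ := PraRel.exists_isBad hM hs hy
    refine LieHom.mem_ker.2 ?_
    refine G.vanish_of_isBad hM hε (by rwa [← hA]) hw hu _ fun t => ?_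
    have := congrArg (fun z => KacMoody.proj RA (Φ z)) (hy t)
    simp only [map_smul] at this
    refine Eq.trans ?_ this
    change ⁅KacMoody.proj RA (Base.cartan RA (ψ t)), KacMoody.proj RA (Φ y)⁆ =
      KacMoody.proj RA (Φ ⁅Base.cartan R t, y⁆)
    rw [LieEquiv.map_lie, hΦ, LieHom.map_lie]
  exact (KacMoody.proj_eq_zero RA).1 (LieHom.mem_ker.1 (hle hx))

/-- The preimages of `e i` and `f i` have weights `ε i α i` and `-ε i α i`. Hence the relations
among the `e i` come from the braid basis with signs `ε`, and those among the `f i` from the one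
with signs `-ε`. -/
theorem symm_mem_praIdeal (hM : IsGIM M) (hs : IsSymmetrizer M s)
    (hε : ∀ i, ε i = 1 ∨ ε i = -1) (hA : ∀ i j, A i j = ε i * ε j * M i j)
    (hsign : ∀ i j, i ≠ j → A i j ≤ 0)
    (hΦ : ∀ x, Φ (Base.cartan R x) = Base.cartan RA (ψ x))
    (hroot : ∀ i x, RA.root i (ψ x) = ε i * R.root i x) {x : Base RA}
    (hx : x ∈ serreIdeal RA) : Φ.symm x ∈ praIdeal R s := by
  have hΦ' : ∀ t y, ⁅Base.cartan R t, Φ.symm y⁆ = Φ.symm ⁅Base.cartan RA (ψ t), y⁆ := by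
    intro t y
    rw [LieEquiv.map_lie, ← hΦ, LieEquiv.symm_apply_apply]
  have he : ∀ i, IsWeightVector R (R.latticeWeight (ε i • Pi.single i 1))
      (Φ.symm (Base.gen RA (Gen.e i))) := by
    intro i t
    refine (hΦ' t _).trans ?_
    rw [Base.cartan_lie_e, hroot, R.latticeWeight_single]
    exact map_smul Φ.symm _ _
  have hf : ∀ i, IsWeightVector R (R.latticeWeight (-ε i • Pi.single i 1))
      (Φ.symm (Base.gen RA (Gen.f i))) := by
    intro i t
    refine (hΦ' t _).trans ?_
    rw [Base.cartan_lie_f, hroot, R.latticeWeight_single, ← neg_smul]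
    refine (map_smul Φ.symm _ _).trans ?_
    congr 1
    simp
  have hε' : ∀ i, -ε i = 1 ∨ -ε i = -1 := fun i => by have := hε i; omega
  have hle : serreIdeal RA ≤ (praIdeal R s).comap Φ.symm.toLieHom := by
    refine LieSubmodule.lieSpan_le.2 fun y hy => ?_
    refine LieIdeal.mem_comap.2 ?_
    induction hy with
    | e_f i j hij =>
      have := lie_mem_praIdeal hM hs hε (by rw [← hA]; exact hsign j i hij.symm) (hf j) (he i)
      rw [← lie_skew, neg_mem_iff] at this
      exact (LieEquiv.map_lie Φ.symm _ _) ▸ this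
    | serre_e i j hij =>
      have := ad_pow_mem_praIdeal hM hs hε (by rw [← hA]; exact hsign i j hij) (he i) (he j)
      rw [← hA] at this
      exact (ad_pow_map Φ.symm.toLieHom _ _ _) ▸ this
    | serre_f i j hij =>
      have := ad_pow_mem_praIdeal hM hs hε'
        (by rw [neg_mul_neg, ← hA]; exact hsign i j hij) (hf i) (hf j)
      rw [neg_mul_neg, ← hA] at this
      exact (ad_pow_map Φ.symm.toLieHom _ _ _) ▸ this
  exact hle hx

theorem exists_quotient_equiv {L L' : Type*} [LieRing L] [LieAlgebra ℂ L] [LieRing L']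
    [LieAlgebra ℂ L'] (φ : L ≃ₗ⁅ℂ⁆ L') (I : LieIdeal ℂ L) (J : LieIdeal ℂ L')
    (hI : ∀ x ∈ I, φ x ∈ J) (hJ : ∀ x ∈ J, φ.symm x ∈ I) :
    ∃ F : (L ⧸ I) ≃ₗ⁅ℂ⁆ (L' ⧸ J), ∀ x : L,
      F (LieSubmodule.Quotient.mk x) = LieSubmodule.Quotient.mk (φ x) := by
  have hmap : (I.toSubmodule).map (φ.toLinearEquiv : L →ₗ[ℂ] L') = J.toSubmodule := by
    ext y
    constructor
    · rintro ⟨x, hx, rfl⟩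
      exact hI x hx
    · intro hy
      exact ⟨φ.symm y, hJ y hy, φ.apply_symm_apply y⟩
  let F := Submodule.Quotient.equiv I.toSubmodule J.toSubmodule φ.toLinearEquiv hmap
  refine ⟨{ F with map_lie' := ?_ }, fun x => rfl⟩
  intro x y
  obtain ⟨x, rfl⟩ := LieSubmodule.Quotient.surjective_mk' _ x
  obtain ⟨y, rfl⟩ := LieSubmodule.Quotient.surjective_mk' _ y
  exact congrArg LieSubmodule.Quotient.mk (φ.map_lie x y)

theorem exists_pra_equiv_kacMoody (hM : IsGIM M) (hs : IsSymmetrizer M s)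
    (hε : ∀ i, ε i = 1 ∨ ε i = -1) (hA : ∀ i j, A i j = ε i * ε j * M i j)
    (hsign : ∀ i j, i ≠ j → A i j ≤ 0)
    (hΦ : ∀ x, Φ (Base.cartan R x) = Base.cartan RA (ψ x))
    (hroot : ∀ i x, RA.root i (ψ x) = ε i * R.root i x)
    (hcoroot : ∀ i, ψ (coroot M i) = (ε i : ℂ) • coroot A i) :
    ∃ F : Pra R s ≃ₗ⁅ℂ⁆ KacMoody RA, ∀ x : Base R,
      F (LieSubmodule.Quotient.mk x) = LieSubmodule.Quotient.mk (Φ x) :=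
  exists_quotient_equiv Φ _ _
    (fun _ => map_mem_serreIdeal hM hs hε hA (hsign 0 1 (by decide)) hΦ hroot hcoroot)
    (fun _ => symm_mem_praIdeal hM hs hε hA hsign hΦ hroot)

theorem exists_pra_equiv_kacMoody_of_isGCM (hM : IsGIM M) (hs : IsSymmetrizer M s)
    (hG : IsGCM M) : ∃ F : Pra R s ≃ₗ⁅ℂ⁆ KacMoody R, ∀ g : Gen M,
      F (Pra.gen R s g) = KacMoody.gen R g := by
  obtain ⟨F, hF⟩ := exists_pra_equiv_kacMoody (R := R) (RA := R) (ε := fun _ => 1)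
    (Φ := LieEquiv.refl) (ψ := LinearEquiv.refl ℂ _) hM hs (fun _ => Or.inl rfl) (by simp)
    hG.nonpos (fun _ => rfl) (by simp) (by simp)
  exact ⟨F, fun g => hF _⟩

end Comparison

/-! ### Changing the signs of simple roots -/

section Twist

/-- Lie algebra homomorphisms out of the Lie algebra defined by the basic relations. -/
def Base.lift {n : ℕ} {M : Matrix (Fin n) (Fin n) ℤ} (R : Realization M) {L : Type*} [LieRing L]
    [LieAlgebra ℂ L] (g : Gen M → L)
    (hg : ∀ x, BaseRel R x → FreeLieAlgebra.lift ℂ g x = 0) : Base R →ₗ⁅ℂ⁆ L :=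
  { (baseIdeal R).toSubmodule.liftQ (FreeLieAlgebra.lift ℂ g : FreeLieAlgebra ℂ (Gen M) →ₗ[ℂ] L)
      (fun x hx => by
        have hle : baseIdeal R ≤ (FreeLieAlgebra.lift ℂ g).ker :=
          LieSubmodule.lieSpan_le.2 fun y hy => LieHom.mem_ker.2 (hg y hy)
        exact LieHom.mem_ker.1 (hle hx)) with
    map_lie' := by
      intro x y
      obtain ⟨x, rfl⟩ := LieSubmodule.Quotient.surjective_mk' _ x
      obtain ⟨y, rfl⟩ := LieSubmodule.Quotient.surjective_mk' _ y
      exact LieHom.map_lie (FreeLieAlgebra.lift ℂ g) x y }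

theorem Base.lift_gen {n : ℕ} {M : Matrix (Fin n) (Fin n) ℤ} (R : Realization M) {L : Type*}
    [LieRing L] [LieAlgebra ℂ L] (g : Gen M → L)
    (hg : ∀ x, BaseRel R x → FreeLieAlgebra.lift ℂ g x = 0) (a : Gen M) :
    Base.lift R g hg (Base.gen R a) = g a :=
  FreeLieAlgebra.lift_of_apply g a

theorem Base.hom_ext {n : ℕ} {M : Matrix (Fin n) (Fin n) ℤ} (R : Realization M) {L : Type*}
    [LieRing L] [LieAlgebra ℂ L] {φ χ : Base R →ₗ⁅ℂ⁆ L}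
    (h : ∀ a, φ (Base.gen R a) = χ (Base.gen R a)) (x : Base R) : φ x = χ x := by
  let π : FreeLieAlgebra ℂ (Gen M) →ₗ⁅ℂ⁆ Base R :=
    { LieSubmodule.Quotient.mk' (baseIdeal R) with map_lie' := rfl }
  obtain ⟨y, rfl⟩ := LieSubmodule.Quotient.surjective_mk' _ x
  have : φ.comp π = χ.comp π := FreeLieAlgebra.hom_ext h
  exact LieHom.congr_fun this y

variable {n : ℕ} {M A : Matrix (Fin n) (Fin n) ℤ}

/-- The images of the generators under the homomorphism which exchanges `e_i` and `f_i` for those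
`i` with `ε i ≠ 1`. -/
def twistGen (R' : Realization A) (ε : Fin n → ℤ) (ψ : Cartan M ≃ₗ[ℂ] Cartan A) : Gen M → Base R'
  | Gen.e i => if ε i = 1 then Base.gen R' (Gen.e i) else Base.gen R' (Gen.f i)
  | Gen.f i => if ε i = 1 then Base.gen R' (Gen.f i) else Base.gen R' (Gen.e i)
  | Gen.h x => Base.cartan R' (ψ x)

theorem lift_twistGen_eq_zero {R : Realization M} {R' : Realization A} {ε : Fin n → ℤ}
    {ψ : Cartan M ≃ₗ[ℂ] Cartan A} (hε : ∀ i, ε i = 1 ∨ ε i = -1)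
    (hroot : ∀ i x, R'.root i (ψ x) = ε i * R.root i x)
    (hcoroot : ∀ i, ψ (coroot M i) = (ε i : ℂ) • coroot A i) (x : FreeLieAlgebra ℂ (Gen M))
    (hx : BaseRel R x) : FreeLieAlgebra.lift ℂ (twistGen R' ε ψ) x = 0 := by
  induction hx with
  | h_add x y => simp [twistGen]
  | h_smul r x => simp [twistGen]
  | h_h x y => simp [twistGen, Base.cartan_lie_cartan]
  | e_f i =>
    simp only [map_sub, LieHom.map_lie, FreeLieAlgebra.lift_of_apply, twistGen, hcoroot]
    rcases hε i with h | h
    · simp [h, Base.e_lie_f]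
    · rw [h, if_neg (by decide), if_neg (by decide), ← lie_skew, Base.e_lie_f]
      simp
  | h_e x i =>
    simp only [map_sub, LieHom.map_lie, map_smul, FreeLieAlgebra.lift_of_apply, twistGen]
    rcases hε i with h | h
    · simp [h, Base.cartan_lie_e, hroot]
    · rw [h, if_neg (by decide), Base.cartan_lie_f, hroot, h]
      simp
  | h_f x i =>
    simp only [map_add, LieHom.map_lie, map_smul, FreeLieAlgebra.lift_of_apply, twistGen]
    rcases hε i with h | h
    · simp [h, Base.cartan_lie_f, hroot]
    · rw [h, if_neg (by decide), Base.cartan_lie_e, hroot, h]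
      simp

/-- The inverse is the same construction for `ψ.symm`, because exchanging `e i` and `f i` twice
changes nothing and `ε i * ε i = 1`. -/
theorem exists_twist_equiv (R : Realization M) (R' : Realization A) {ε : Fin n → ℤ}
    (ψ : Cartan M ≃ₗ[ℂ] Cartan A) (hε : ∀ i, ε i = 1 ∨ ε i = -1)
    (hroot : ∀ i x, R'.root i (ψ x) = ε i * R.root i x)
    (hcoroot : ∀ i, ψ (coroot M i) = (ε i : ℂ) • coroot A i) :
    ∃ Φ : Base R ≃ₗ⁅ℂ⁆ Base R', ∀ x, Φ (Base.cartan R x) = Base.cartan R' (ψ x) := by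
  have hε2 : ∀ i, (ε i : ℂ) * ε i = 1 := by
    intro i
    rcases hε i with h | h <;> rw [h] <;> simp
  have hroot' : ∀ i x, R.root i (ψ.symm x) = ε i * R'.root i x := by
    intro i x
    obtain ⟨x, rfl⟩ := ψ.surjective x
    rw [hroot, ← mul_assoc, hε2, one_mul, LinearEquiv.symm_apply_apply]
  have hcoroot' : ∀ i, ψ.symm (coroot A i) = (ε i : ℂ) • coroot M i := by
    intro i
    rw [LinearEquiv.symm_apply_eq, map_smul, hcoroot, smul_smul, hε2, one_smul]
  let F := Base.lift R _ (lift_twistGen_eq_zero (R := R) hε hroot hcoroot)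
  let F' := Base.lift R' _ (lift_twistGen_eq_zero (R := R') hε hroot' hcoroot')
  have hFh : ∀ x, F (Base.cartan R x) = Base.cartan R' (ψ x) := fun x =>
    Base.lift_gen R _ _ (Gen.h x)
  have hFh' : ∀ x, F' (Base.cartan R' x) = Base.cartan R (ψ.symm x) := fun x =>
    Base.lift_gen R' _ _ (Gen.h x)
  have hF : ∀ a, F (Base.gen R a) = twistGen R' ε ψ a := Base.lift_gen R _ _
  have hF' : ∀ a, F' (Base.gen R' a) = twistGen R ε ψ.symm a := Base.lift_gen R' _ _
  refine ⟨{ F with invFun := F', left_inv := ?_, right_inv := ?_ }, hFh⟩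
  · refine Base.hom_ext R (φ := F'.comp F) (χ := LieHom.id) ?_
    rintro (i | i | x)
    · rw [LieHom.comp_apply, hF, twistGen]
      split_ifs with h <;> rw [hF'] <;> simp [twistGen, h]
    · rw [LieHom.comp_apply, hF, twistGen]
      split_ifs with h <;> rw [hF'] <;> simp [twistGen, h]
    · change F' (F (Base.cartan R x)) = Base.cartan R x
      rw [hFh, hFh', LinearEquiv.symm_apply_apply]
  · refine Base.hom_ext R' (φ := F.comp F') (χ := LieHom.id) ?_
    rintro (i | i | x)
    · rw [LieHom.comp_apply, hF', twistGen]
      split_ifs with h <;> rw [hF] <;> simp [twistGen, h]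
    · rw [LieHom.comp_apply, hF', twistGen]
      split_ifs with h <;> rw [hF] <;> simp [twistGen, h]
    · change F (F' (Base.cartan R' x)) = Base.cartan R' x
      rw [hFh', hFh, LinearEquiv.apply_symm_apply]

/-- The matrix obtained from `M` by changing the signs of the simple roots `α_i` with `ε i = -1`. -/
def signTwist (M : Matrix (Fin n) (Fin n) ℤ) (ε : Fin n → ℤ) : Matrix (Fin n) (Fin n) ℤ :=
  Matrix.of fun i j => ε i * ε j * M i j

theorem corank_signTwist (M : Matrix (Fin n) (Fin n) ℤ) {ε : Fin n → ℤ}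
    (hε : ∀ i, ε i = 1 ∨ ε i = -1) : corank (signTwist M ε) = corank M := by
  have hdet : IsUnit (Matrix.diagonal fun i => (ε i : ℂ)).det := by
    rw [Matrix.det_diagonal, isUnit_iff_ne_zero, Finset.prod_ne_zero_iff]
    intro i _
    rcases hε i with h | h <;> rw [h] <;> simp
  have : (signTwist M ε).map (Int.cast : ℤ → ℂ) = Matrix.diagonal (fun i => (ε i : ℂ)) *
      M.map (Int.cast : ℤ → ℂ) * Matrix.diagonal (fun i => (ε i : ℂ)) := by
    ext i j
    simp [signTwist, Matrix.diagonal_mul, Matrix.mul_diagonal]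
    ring
  rw [corank, corank, this, Matrix.rank_mul_eq_left_of_isUnit_det _ _ hdet,
    Matrix.rank_mul_eq_right_of_isUnit_det _ _ hdet]

/-- The isomorphism of Cartan subalgebras which maps `h_i` to `ε i • h_i`. -/
def signTwistCartan (M : Matrix (Fin n) (Fin n) ℤ) {ε : Fin n → ℤ}
    (hε : ∀ i, ε i = 1 ∨ ε i = -1) : Cartan M ≃ₗ[ℂ] Cartan (signTwist M ε) :=
  LinearEquiv.piCongrLeft' ℂ (fun _ => ℂ)
      (Equiv.sumCongr (Equiv.refl _) (finCongr (corank_signTwist M hε).symm)) ≪≫ₗ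
    LinearEquiv.piCongrRight fun k => LinearEquiv.smulOfNeZero ℂ ℂ
      (Sum.elim (fun i => (ε i : ℂ)) (fun _ => 1) k) (by
        rcases k with i | k
        · rcases hε i with h | h <;> simp [h]
        · simp)

theorem signTwistCartan_coroot (M : Matrix (Fin n) (Fin n) ℤ) {ε : Fin n → ℤ}
    (hε : ∀ i, ε i = 1 ∨ ε i = -1) (i : Fin n) :
    signTwistCartan M hε (coroot M i) = (ε i : ℂ) • coroot (signTwist M ε) i := by
  funext k
  rcases k with j | k
  · change (ε j : ℂ) * (Pi.single (Sum.inl i) 1 : Cartan M) (Sum.inl j) =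
      ε i * (Pi.single (Sum.inl i) 1 : Cartan (signTwist M ε)) (Sum.inl j)
    by_cases hj : j = i
    · subst hj; simp
    · simp [hj]
  · simp [signTwistCartan, coroot]

/-- Roots and coroots are both scaled by `ε`, so the pairing of `α i` with `h j` acquires `ε i * ε
j`. Equality of the coranks makes the two Cartan spaces isomorphic. -/
theorem exists_realization_signTwist (R : Realization M) {ε : Fin n → ℤ}
    (hε : ∀ i, ε i = 1 ∨ ε i = -1) :
    ∃ (R' : Realization (signTwist M ε)) (ψ : Cartan M ≃ₗ[ℂ] Cartan (signTwist M ε)),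
      (∀ i x, R'.root i (ψ x) = ε i * R.root i x) ∧
      ∀ i, ψ (coroot M i) = (ε i : ℂ) • coroot (signTwist M ε) i := by
  have hε2 : ∀ i, (ε i : ℂ) * ε i = 1 := by
    intro i
    rcases hε i with h | h <;> rw [h] <;> simp
  have hcoroot := signTwistCartan_coroot M hε
  generalize signTwistCartan M hε = ψ at hcoroot
  have hcoroot' : ∀ i, ψ.symm (coroot (signTwist M ε) i) = (ε i : ℂ) • coroot M i := by
    intro i
    rw [LinearEquiv.symm_apply_eq, map_smul, hcoroot, smul_smul, hε2, one_smul]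
  have hli : LinearIndependent ℂ fun i => (R.root i ∘ₗ ψ.symm.toLinearMap) :=
    R.linearIndependent.map' ψ.symm.toLinearMap.dualMap
      (LinearMap.ker_eq_bot.2 (LinearMap.dualMap_injective_of_surjective ψ.symm.surjective))
  refine ⟨⟨fun i => (ε i : ℂ) • (R.root i ∘ₗ ψ.symm.toLinearMap), ?_, ?_⟩, ψ, ?_, hcoroot⟩
  · exact hli.units_smul fun i => ⟨ε i, ε i, hε2 i, hε2 i⟩
  · intro i j
    rw [LinearMap.smul_apply, LinearMap.comp_apply, LinearEquiv.coe_coe, hcoroot', map_smul,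
      R.root_coroot, signTwist, Matrix.of_apply, smul_eq_mul, smul_eq_mul]
    push_cast
    ring
  · intro i x
    rw [LinearMap.smul_apply, LinearMap.comp_apply, LinearEquiv.coe_coe,
      LinearEquiv.symm_apply_apply, smul_eq_mul]

end Twist

end GIM

end

theorem lemma8 (M : Matrix (Fin 2) (Fin 2) ℤ) (hM : GIM.IsGIM M)
    (s : Fin 2 → ℝ) (hs : GIM.IsSymmetrizer M s) (R : GIM.Realization M) :
    (∃ (A : Matrix (Fin 2) (Fin 2) ℤ) (RA : GIM.Realization A),
      GIM.IsGCM A ∧ (∀ i j, i ≠ j → A i j = -|M i j|) ∧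
      Nonempty (GIM.Pra R s ≃ₗ⁅ℂ⁆ GIM.KacMoody RA)) ∧
    (GIM.IsGCM M → ∃ φ : GIM.Pra R s ≃ₗ⁅ℂ⁆ GIM.KacMoody R,
      ∀ g : GIM.Gen M, φ (GIM.Pra.gen R s g) = GIM.KacMoody.gen R g) := by
  refine ⟨?_, GIM.exists_pra_equiv_kacMoody_of_isGCM hM hs⟩
  have hneg := hM.neg_iff 0 1 (by decide)
  have hpos := hM.pos_iff 0 1 (by decide)
  have hd0 := hM.diag 0
  have hd1 := hM.diag 1
  rcases le_or_gt (M 0 1) 0 with h | h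
  · have hnonpos : ∀ i j, i ≠ j → M i j ≤ 0 := by
      intro i j hij
      fin_cases i <;> fin_cases j <;> simp at hij ⊢ <;> omega
    have hG : GIM.IsGCM M := by
      refine ⟨hM.diag, hnonpos, fun i j => ?_⟩
      fin_cases i <;> fin_cases j <;> simp <;> omega
    obtain ⟨F, -⟩ := GIM.exists_pra_equiv_kacMoody_of_isGCM (R := R) hM hs hG
    exact ⟨M, R, hG, fun i j hij => by rw [abs_of_nonpos (hnonpos i j hij), neg_neg], ⟨F⟩⟩
  -- Negating just one of the two simple roots reverses the sign of both off-diagonal entries.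
  · have hε : ∀ i, (![-1, 1] : Fin 2 → ℤ) i = 1 ∨ (![-1, 1] : Fin 2 → ℤ) i = -1 := by decide
    have hM' : ∀ i j, i ≠ j → 0 < M i j := by
      intro i j hij
      fin_cases i <;> fin_cases j <;> simp at hij ⊢ <;> omega
    have hA : ∀ i j, i ≠ j → GIM.signTwist M ![-1, 1] i j = -M i j := by
      intro i j hij
      fin_cases i <;> fin_cases j <;> simp [GIM.signTwist] at hij ⊢
    have hG : GIM.IsGCM (GIM.signTwist M ![-1, 1]) := by
      refine ⟨fun i => ?_, fun i j hij => ?_, fun i j => ?_⟩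
      · fin_cases i <;> simp [GIM.signTwist, hd0, hd1]
      · rw [hA i j hij]
        exact neg_nonpos.2 (hM' i j hij).le
      · by_cases hij : i = j
        · subst hij; rfl
        · rw [hA i j hij, hA j i (Ne.symm hij), neg_eq_zero, neg_eq_zero]
          exact iff_of_false (hM' i j hij).ne' (hM' j i (Ne.symm hij)).ne'
    obtain ⟨RA, ψ, hroot, hcoroot⟩ := GIM.exists_realization_signTwist R hε
    obtain ⟨Φ, hΦ⟩ := GIM.exists_twist_equiv R RA ψ hε hroot hcoroot
    obtain ⟨F, -⟩ := GIM.exists_pra_equiv_kacMoody hM hs hε (fun _ _ => rfl) hG.nonpos hΦ hroot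
      hcoroot
    exact ⟨_, RA, hG, fun i j hij => by rw [hA i j hij, abs_of_pos (hM' i j hij)], ⟨F⟩⟩
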